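/- Let $a_1,a_2,b\in\mathbb R$. For a sampling period $h>0$ put $t_k=kh$, $k=0,1,2,\dots$. Let $q\in\mathbb N$, gains $k_p,k_i,k_d\in\mathbb R$ and a threshold $\sigma\in[0,1)$ be given. The event-triggered PID controller is defined by $$u(t_k)=k_py(t_k)+k_ih\sum_{j=0}^{k-1}y(t_j)+k_d\,y(t_{k-q}),\qquad y(t_{k-q})=0\ \text{for } k<q,$$ $\hat u_0=u(t_0)$ and, for $k\ge1$, $\hat u_k=u(t_k)$ if $(u(t_k)-\hat u_{k-1})^2>\sigma u(t_k)^2$ and $\hat u_k=\hat u_{k-1}$ otherwise. It is applied to the plant $$\ddot y(t)+a_1\dot y(t)+a_2y(t)=b\hat u_k,\qquad t\in[t_k,t_{k+1}),\ k=0,1,2,\dots,\tag{1}$$ where $y,\dot y$ are continuous on $[0,\infty)$. The continuous PID controller $u(t)=\bar k_py(t)+\bar k_i\int_0^ty(s)\,ds+\bar k_d\dot y(t)$ is applied to the plant $$\ddot y(t)+a_1\dot y(t)+a_2y(t)=bu(t),\qquad t\ge0.\tag{2}$$ A controller exponentially stabilizes its plant with decay rate $\alpha$ if there is a constant $M$ such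 that all solutions satisfy $\|\xi(t)\|\le Me^{-\alpha t}\|\xi(0)\|$ for all $t\ge0$, where $\xi=(y,\dot y)$. It does so including the integral state if the same holds for $\xi=(y,\dot y,x_3)$, where $x_3(t)=\int_0^ty(s)\,ds$ for (2), and $x_3(t)=(t-t_k)y(t_k)+h\sum_{j=0}^{k-1}y(t_j)$ on $[t_k,t_{k+1})$ for (1). (i) Let $h>0$, $q\ge1$, $k_p,k_i,k_d\in\mathbb R$, $\sigma\in[0,1)$, $\alpha>0$. Put $$A=\begin{bmatrix}0&1&0\\-a_2+b(k_p+k_d)&-a_1-qhbk_d&bk_i\\1&0&0\end{bmatrix},\quad A_v=\begin{bmatrix}0&0&0\\bk_p&0&bk_i\\1&0&0\end{bmatrix},\quad B=\begin{bmatrix}0\\b\\0\end{bmatrix},\quad E=\begin{bmatrix}0&0&0\\0&1&0\\0&0&0\end{bmatrix}.$$ Suppose that there are positive definite $P,S\in\mathbb R^{3\times3}$ and nonnegative scalars $W,R,\omega$ such that $\Psi\le0$ (negative semidefinite), where, with $G=h^2e^{2\alpha h}S+R\,k_d^2(qh)^2E$, $\Psi=\{\Psi_{ij}\}_{i,j=1}^7$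 is the symmetric block matrix whose nonzero blocks with $i\le j$ are $$\begin{aligned} &\Psi_{11}=PA+A^TP+2\alpha P+Wk_d^2h^2e^{2\alpha h}E,\quad \Psi_{12}=\sqrt h\,PA_v,\quad \Psi_{13}=\Psi_{14}=\Psi_{15}=PB,\\ &\Psi_{16}=\omega\sigma\,[k_p+k_d,\,-qhk_d,\,k_i]^T,\quad \Psi_{17}=A^TG,\\ &\Psi_{22}=-\tfrac{\pi^2}{4}hS,\quad \Psi_{26}=\omega\sigma\sqrt h\,[k_p,\,0,\,k_i]^T,\quad \Psi_{27}=\sqrt h\,A_v^TG,\\ &\Psi_{33}=-W\tfrac{\pi^2}{4}e^{-2\alpha qh},\quad \Psi_{44}=-R\tfrac{4}{(qh)^2}e^{-2\alpha qh},\quad \Psi_{36}=\Psi_{46}=\omega\sigma,\\ &\Psi_{37}=\Psi_{47}=\Psi_{57}=B^TG,\quad \Psi_{55}=-\omega,\quad \Psi_{66}=-\omega\sigma,\quad \Psi_{77}=-G. \end{aligned}$$ Then the event-triggered PID controller exponentially stabilizes (1) with decay rate $\alpha$, also including the integral state. (ii) Let $\alpha'>0$ and let $\bar k_p,\bar k_i,\bar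 k_d$ be such that the continuous PID controller exponentially stabilizes (2) with decay rate $\alpha'$. Then for every $\alpha<\alpha'$ there are $h_0,\sigma_0>0$ such that for all $h\in(0,h_0)$ and all $\sigma\in[0,1)$ with $\sigma<\sigma_0$ the event-triggered PID controller with $$q=\lfloor h^{-1/2}\rfloor,\qquad k_p=\bar k_p+\frac{\bar k_d}{qh},\qquad k_i=\bar k_i,\qquad k_d=-\frac{\bar k_d}{qh}$$ exponentially stabilizes (1) with decay rate $\alpha$. The same holds with "exponentially stabilizes" read as including the integral state both in the hypothesis and in the conclusion. -/

import Mathlib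

open scoped Matrix

noncomputable section

namespace PID

/-! ### Continuous-time PID control -/

/-- The PID control law `u(t) = kp y(t) + ki ∫₀ᵗ y(s) ds + kd y'(t)`; here `dy` is the
derivative of `y`. -/
def pidControl (kp ki kd : ℝ) (y dy : ℝ → ℝ) (t : ℝ) : ℝ :=
  kp * y t + ki * (∫ s in (0 : ℝ)..t, y s) + kd * dy t

/-- `y`, with derivative `dy`, solves `y'' + a₁ y' + a₂ y = b u` on `[0, ∞)` under the PID
control law `u = pidControl kp ki kd y dy`. -/
structure IsPIDSolution (a₁ a₂ b kp ki kd : ℝ) (y dy : ℝ → ℝ) : Prop where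
  hasDeriv_y : ∀ t, 0 ≤ t → HasDerivWithinAt y (dy t) (Set.Ici 0) t
  hasDeriv_dy : ∀ t, 0 ≤ t →
    HasDerivWithinAt dy (b * pidControl kp ki kd y dy t - a₁ * dy t - a₂ * y t) (Set.Ici 0) t

/-! ### Event-triggered sampled-data PID control -/

/-- The delayed sample `y(t_{k-q})`, which is `0` for `k < q`. -/
def delayedSample (h : ℝ) (q : ℕ) (y : ℝ → ℝ) (k : ℕ) : ℝ :=
  if k < q then 0 else y (((k - q : ℕ) : ℝ) * h)

/-- The sampled-data control value `u(t_k)`, where `t_k = k h`: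
`u(t_k) = kp y(t_k) + ki h ∑_{j=0}^{k-1} y(t_j) + kd y(t_{k-q})`. -/
def sampledControl (h : ℝ) (q : ℕ) (kp ki kd : ℝ) (y : ℝ → ℝ) (k : ℕ) : ℝ :=
  kp * y ((k : ℝ) * h) + ki * h * (∑ j ∈ Finset.range k, y ((j : ℝ) * h))
    + kd * delayedSample h q y k

/-- The event-triggered control `û_k` made from the values `u k = u(t_k)`: `û_0 = u(t_0)`, and
`û_k` is `u(t_k)` if `(u(t_k) - û_{k-1})² > σ u(t_k)²`, and `û_{k-1}` otherwise. -/
def eventControl (σ : ℝ) (u : ℕ → ℝ) : ℕ → ℝ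
  | 0 => u 0
  | k + 1 =>
    if (u (k + 1) - eventControl σ u k) ^ 2 > σ * u (k + 1) ^ 2 then u (k + 1)
    else eventControl σ u k

/-- `y`, with derivative `dy`, solves `y'' + a₁ y' + a₂ y = b û_k` on `[t_k, t_{k+1})`,
`k = 0, 1, 2, …`, where `t_k = k h` and `û_k` is the event-triggered sampled-data PID control.
Both `y` and `y'` are continuous on `[0, ∞)`; the second derivative at `t_k` is one-sided. -/
structure IsEventSolution (a₁ a₂ b h : ℝ) (q : ℕ) (kp ki kd σ : ℝ) (y dy : ℝ → ℝ) : Prop where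
  hasDeriv_y : ∀ t, 0 ≤ t → HasDerivWithinAt y (dy t) (Set.Ici 0) t
  continuousOn_dy : ContinuousOn dy (Set.Ici 0)
  hasDeriv_dy : ∀ k : ℕ, ∀ t ∈ Set.Ico ((k : ℝ) * h) (((k : ℝ) + 1) * h),
    HasDerivWithinAt dy
      (b * eventControl σ (sampledControl h q kp ki kd y) k - a₁ * dy t - a₂ * y t)
      (Set.Ico ((k : ℝ) * h) (((k : ℝ) + 1) * h)) t

/-- The integral state of the sampled-data controller:
`(t - t_k) y(t_k) + h ∑_{j=0}^{k-1} y(t_j)` for `t ∈ [t_k, t_{k+1})`. -/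
def sampledIntegral (h : ℝ) (y : ℝ → ℝ) (t : ℝ) : ℝ :=
  (t - (⌊t / h⌋₊ : ℝ) * h) * y ((⌊t / h⌋₊ : ℝ) * h)
    + h * ∑ j ∈ Finset.range ⌊t / h⌋₊, y ((j : ℝ) * h)

/-! ### Exponential stability -/

/-- `‖x(t)‖ ≤ M e^{-α t} ‖x(0)‖` for all `t ≥ 0`. -/
def DecaysExp {n : ℕ} (α M : ℝ) (x : ℝ → EuclideanSpace ℝ (Fin n)) : Prop :=
  ∀ t, 0 ≤ t → ‖x t‖ ≤ M * Real.exp (-α * t) * ‖x 0‖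

/-- The PID controller exponentially stabilizes the plant, with decay rate `α`: the plant state
`(y, y')` decays, with a constant independent of the solution. -/
def PIDStabilizes (a₁ a₂ b kp ki kd α : ℝ) : Prop :=
  ∃ M : ℝ, ∀ y dy : ℝ → ℝ, IsPIDSolution a₁ a₂ b kp ki kd y dy →
    DecaysExp α M (fun t => !₂[y t, dy t])

/-- As `PIDStabilizes`, for the state `(y, y', ∫₀ᵗ y)` of plant and controller together. -/
def PIDStabilizesFull (a₁ a₂ b kp ki kd α : ℝ) : Prop :=
  ∃ M : ℝ, ∀ y dy : ℝ → ℝ, IsPIDSolution a₁ a₂ b kp ki kd y dy →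
    DecaysExp α M (fun t => !₂[y t, dy t, ∫ s in (0 : ℝ)..t, y s])

/-- The event-triggered sampled-data PID controller exponentially stabilizes the plant, with
decay rate `α`: the plant state `(y, y')` decays, with a constant independent of the solution. -/
def EventStabilizes (a₁ a₂ b h : ℝ) (q : ℕ) (kp ki kd σ α : ℝ) : Prop :=
  ∃ M : ℝ, ∀ y dy : ℝ → ℝ, IsEventSolution a₁ a₂ b h q kp ki kd σ y dy →
    DecaysExp α M (fun t => !₂[y t, dy t])

/-- As `EventStabilizes`, for the state of plant and controller integral together. -/
def EventStabilizesFull (a₁ a₂ b h : ℝ) (q : ℕ) (kp ki kd σ α : ℝ) : Prop :=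
  ∃ M : ℝ, ∀ y dy : ℝ → ℝ, IsEventSolution a₁ a₂ b h q kp ki kd σ y dy →
    DecaysExp α M (fun t => !₂[y t, dy t, sampledIntegral h y t])

/-! ### The linear matrix inequality -/

/-- The matrix `A` of the closed loop. -/
def matA (a₁ a₂ b h : ℝ) (q : ℕ) (kp ki kd : ℝ) : Matrix (Fin 3) (Fin 3) ℝ :=
  !![0, 1, 0;
     -a₂ + b * (kp + kd), -a₁ - q * h * b * kd, b * ki;
     1, 0, 0]

/-- The matrix `A_v` of the closed loop. -/
def matAv (b kp ki : ℝ) : Matrix (Fin 3) (Fin 3) ℝ :=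
  !![0, 0, 0;
     b * kp, 0, b * ki;
     1, 0, 0]

/-- The column `B` of the closed loop. -/
def matB (b : ℝ) : Matrix (Fin 3) (Fin 1) ℝ := !![0; b; 0]

/-- The matrix with a one in the middle and zeros elsewhere. -/
def matE : Matrix (Fin 3) (Fin 3) ℝ := !![0, 0, 0; 0, 1, 0; 0, 0, 0]

/-- `G = h² e^{2αh} S + E R kd² (q h)²`. -/
def matG (h : ℝ) (q : ℕ) (kd α : ℝ) (S : Matrix (Fin 3) (Fin 3) ℝ) (R : ℝ) :
    Matrix (Fin 3) (Fin 3) ℝ :=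
  (h ^ 2 * Real.exp (2 * α * h)) • S + (R * kd ^ 2 * (q * h) ^ 2) • matE

/-- The index type of the seven blocks, of sizes `3, 3, 1, 1, 1, 1, 3`. -/
abbrev LMIIndex : Type := Fin 3 ⊕ Fin 3 ⊕ Fin 1 ⊕ Fin 1 ⊕ Fin 1 ⊕ Fin 1 ⊕ Fin 3

/-- The symmetric `7 × 7` block matrix `Ψ`, built from its blocks `Ψij` with `i ≤ j`; those that
are not listed in the `let`s are zero. -/
def matΨ (a₁ a₂ b h : ℝ) (q : ℕ) (kp ki kd σ α : ℝ)
    (P S : Matrix (Fin 3) (Fin 3) ℝ) (W R ω : ℝ) : Matrix LMIIndex LMIIndex ℝ :=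
  let A := matA a₁ a₂ b h q kp ki kd
  let Av := matAv b kp ki
  let B := matB b
  let G := matG h q kd α S R
  let Ψ11 : Matrix (Fin 3) (Fin 3) ℝ :=
    P * A + Aᵀ * P + (2 * α) • P + (W * kd ^ 2 * h ^ 2 * Real.exp (2 * α * h)) • matE
  let Ψ12 : Matrix (Fin 3) (Fin 3) ℝ := √h • (P * Av)
  let Ψ13 : Matrix (Fin 3) (Fin 1) ℝ := P * B
  let Ψ14 : Matrix (Fin 3) (Fin 1) ℝ := P * B
  let Ψ15 : Matrix (Fin 3) (Fin 1) ℝ := P * B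
  let Ψ16 : Matrix (Fin 3) (Fin 1) ℝ := (ω * σ) • !![kp + kd; -(q * h * kd); ki]
  let Ψ17 : Matrix (Fin 3) (Fin 3) ℝ := Aᵀ * G
  let Ψ22 : Matrix (Fin 3) (Fin 3) ℝ := (-(Real.pi ^ 2 / 4) * h) • S
  let Ψ26 : Matrix (Fin 3) (Fin 1) ℝ := (ω * σ * √h) • !![kp; 0; ki]
  let Ψ27 : Matrix (Fin 3) (Fin 3) ℝ := √h • (Avᵀ * G)
  let Ψ33 : Matrix (Fin 1) (Fin 1) ℝ :=
    !![-W * (Real.pi ^ 2 / 4) * Real.exp (-2 * α * q * h)]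
  let Ψ36 : Matrix (Fin 1) (Fin 1) ℝ := !![ω * σ]
  let Ψ37 : Matrix (Fin 1) (Fin 3) ℝ := Bᵀ * G
  let Ψ44 : Matrix (Fin 1) (Fin 1) ℝ :=
    !![-R * (4 / (q * h) ^ 2) * Real.exp (-2 * α * q * h)]
  let Ψ46 : Matrix (Fin 1) (Fin 1) ℝ := !![ω * σ]
  let Ψ47 : Matrix (Fin 1) (Fin 3) ℝ := Bᵀ * G
  let Ψ55 : Matrix (Fin 1) (Fin 1) ℝ := !![-ω]
  let Ψ57 : Matrix (Fin 1) (Fin 3) ℝ := Bᵀ * G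
  let Ψ66 : Matrix (Fin 1) (Fin 1) ℝ := !![-(ω * σ)]
  let Ψ77 : Matrix (Fin 3) (Fin 3) ℝ := -G
  -- the parts of the block rows strictly to the right of the diagonal
  let row1 : Matrix (Fin 3) (Fin 3 ⊕ Fin 1 ⊕ Fin 1 ⊕ Fin 1 ⊕ Fin 1 ⊕ Fin 3) ℝ :=
    .fromCols Ψ12 (.fromCols Ψ13 (.fromCols Ψ14 (.fromCols Ψ15 (.fromCols Ψ16 Ψ17))))
  let row2 : Matrix (Fin 3) (Fin 1 ⊕ Fin 1 ⊕ Fin 1 ⊕ Fin 1 ⊕ Fin 3) ℝ :=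
    .fromCols 0 (.fromCols 0 (.fromCols 0 (.fromCols Ψ26 Ψ27)))
  let row3 : Matrix (Fin 1) (Fin 1 ⊕ Fin 1 ⊕ Fin 1 ⊕ Fin 3) ℝ :=
    .fromCols 0 (.fromCols 0 (.fromCols Ψ36 Ψ37))
  let row4 : Matrix (Fin 1) (Fin 1 ⊕ Fin 1 ⊕ Fin 3) ℝ := .fromCols 0 (.fromCols Ψ46 Ψ47)
  let row5 : Matrix (Fin 1) (Fin 1 ⊕ Fin 3) ℝ := .fromCols 0 Ψ57
  let row6 : Matrix (Fin 1) (Fin 3) ℝ := 0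
  .fromBlocks Ψ11 row1 row1ᵀ <|
  .fromBlocks Ψ22 row2 row2ᵀ <|
  .fromBlocks Ψ33 row3 row3ᵀ <|
  .fromBlocks Ψ44 row4 row4ᵀ <|
  .fromBlocks Ψ55 row5 row5ᵀ <|
  .fromBlocks Ψ66 row6 row6ᵀ Ψ77

/-- Feasibility of the LMI: `Ψ ≤ 0` for some positive definite `P`, `S` and nonnegative `W`,
`R`, `ω`. -/
def LMIFeasible (a₁ a₂ b h : ℝ) (q : ℕ) (kp ki kd σ α : ℝ) : Prop :=
  ∃ (P S : Matrix (Fin 3) (Fin 3) ℝ) (W R ω : ℝ),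
    P.PosDef ∧ S.PosDef ∧ 0 ≤ W ∧ 0 ≤ R ∧ 0 ≤ ω ∧
      (-(matΨ a₁ a₂ b h q kp ki kd σ α P S W R ω)).PosSemidef

/-- The discrete delay `q = ⌊h^{-1/2}⌋`. -/
def delayOf (h : ℝ) : ℕ := ⌊h ^ (-(1 / 2) : ℝ)⌋₊

end PID

end

/-!
Part (i). Along a solution, `V = x ⬝ P x` satisfies `V' + 2 α V ≤` (weighted squares of the errors
made by sampling, by the finite difference and by the trigger) `-` (weighted squares of `x'`), which
is what `Ψ ≤ 0` says once its Schur complements are undone. After integration against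
`exp (2 α t)`, Wirtinger's inequality bounds the sampling errors and the Cauchy-Schwarz inequality
for Taylor's remainder bounds the finite-difference error by the integrals of the squares of `x'`,
the trigger rule bounds its own error, and `exp (2 α t) * V` stays bounded by the data of the first
`q` sampling steps.

Part (ii). With the gains of (ii) the controller uses the difference quotient of `y` over the delay
`q h ≈ √h`. The event-triggered loop is then the continuous loop up to a perturbation that is small,
relative to the size of the state in the norm weighted by `exp (α t)`, when `h` and `σ` are small;
variation of constants and a small-gain argument transfer the decay.
-/

namespace PID

open Set Filter Topology MeasureTheory

/-! ### Measurable, locally bounded functions -/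

/-- Measurable functions on the line that are bounded on bounded intervals. All integrands of the
Lyapunov functional are of this kind, and the class is closed under the operations that form
them. -/
@[fun_prop]
structure LocBdd (f : ℝ → ℝ) : Prop where
  measurable : Measurable f
  bdd : ∀ r s : ℝ, ∃ C, ∀ t ∈ Icc r s, |f t| ≤ C

namespace LocBdd

variable {f g : ℝ → ℝ}

lemma of_continuous (hf : Continuous f) : LocBdd f where
  measurable := hf.measurable
  bdd _ _ := isCompact_Icc.exists_bound_of_continuousOn hf.continuousOn

@[fun_prop]
lemma id : LocBdd fun t => t := of_continuous continuous_id

@[fun_prop]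
lemma const (c : ℝ) : LocBdd fun _ => c := of_continuous continuous_const

@[fun_prop]
lemma comp (hf : LocBdd f) (hg : LocBdd g) : LocBdd fun t => f (g t) where
  measurable := hf.measurable.comp hg.measurable
  bdd r s := by
    obtain ⟨D, hD⟩ := hg.bdd r s
    obtain ⟨C, hC⟩ := hf.bdd (-D) D
    exact ⟨C, fun t ht => hC _ (abs_le.1 (hD t ht))⟩

@[fun_prop]
lemma add (hf : LocBdd f) (hg : LocBdd g) : LocBdd fun t => f t + g t where
  measurable := hf.measurable.add hg.measurable
  bdd r s := by
    obtain ⟨C, hC⟩ := hf.bdd r s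
    obtain ⟨D, hD⟩ := hg.bdd r s
    exact ⟨C + D, fun t ht => (abs_add_le _ _).trans (add_le_add (hC t ht) (hD t ht))⟩

@[fun_prop]
lemma mul (hf : LocBdd f) (hg : LocBdd g) : LocBdd fun t => f t * g t where
  measurable := hf.measurable.mul hg.measurable
  bdd r s := by
    obtain ⟨C, hC⟩ := hf.bdd r s
    obtain ⟨D, hD⟩ := hg.bdd r s
    refine ⟨C * D, fun t ht => ?_⟩
    rw [abs_mul]
    exact mul_le_mul (hC t ht) (hD t ht) (abs_nonneg _) ((abs_nonneg _).trans (hC t ht))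

@[fun_prop]
lemma sub (hf : LocBdd f) (hg : LocBdd g) : LocBdd fun t => f t - g t := by
  simpa [sub_eq_add_neg] using hf.add ((const (-1)).mul hg)

@[fun_prop]
lemma pow (hf : LocBdd f) (n : ℕ) : LocBdd fun t => f t ^ n :=
  (of_continuous (continuous_pow n)).comp hf

@[fun_prop]
lemma exp (hf : LocBdd f) : LocBdd fun t => Real.exp (f t) :=
  (of_continuous Real.continuous_exp).comp hf

@[fun_prop]
lemma sum {ι : Type*} {s : Finset ι} {f : ι → ℝ → ℝ} (hf : ∀ i ∈ s, LocBdd (f i)) :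
    LocBdd fun t => ∑ i ∈ s, f i t := by
  induction s using Finset.cons_induction with
  | empty => simpa using const 0
  | cons i s _ ih =>
    simp only [Finset.sum_cons]
    exact (hf i (Finset.mem_cons_self i s)).add
      (ih fun j hj => hf j (Finset.mem_cons_of_mem hj))

lemma step {h : ℝ} (hh : 0 < h) (c : ℕ → ℝ) : LocBdd fun t => c ⌊t / h⌋₊ where
  measurable := (measurable_from_top (f := c)).comp
    (Nat.measurable_floor.comp (measurable_id.div_const h))
  bdd r s := by
    refine ⟨∑ k ∈ Finset.range (⌊s / h⌋₊ + 1), |c k|, fun t ht => ?_⟩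
    refine Finset.single_le_sum (f := fun k => |c k|) (fun _ _ => abs_nonneg _) ?_
    rw [Finset.mem_range, Nat.lt_succ_iff]
    exact Nat.floor_mono (div_le_div_of_nonneg_right ht.2 hh.le)

lemma intervalIntegrable (hf : LocBdd f) (r s : ℝ) : IntervalIntegrable f volume r s := by
  obtain ⟨C, hC⟩ := hf.bdd (min r s) (max r s)
  rw [intervalIntegrable_iff]
  refine Measure.integrableOn_of_bounded (M := C) (by simp) hf.measurable.aestronglyMeasurable ?_
  exact (ae_restrict_iff' measurableSet_uIoc).2 (.of_forall fun t ht => hC t ⟨ht.1.le, ht.2⟩)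

end LocBdd

/-! ### The sampling grid -/

section Grid

variable {h t : ℝ}

lemma floor_div_eq (hh : 0 < h) {k : ℕ} (ht : t ∈ Ico (k * h) ((k + 1) * h)) : ⌊t / h⌋₊ = k := by
  have h0 : 0 ≤ t / h := div_nonneg (le_trans (by positivity) ht.1) hh.le
  exact (Nat.floor_eq_iff h0).2 ⟨(le_div_iff₀ hh).2 ht.1, (div_lt_iff₀ hh).2 ht.2⟩

lemma mem_Ico_floor_mul (hh : 0 < h) (ht : 0 ≤ t) :
    t ∈ Ico (⌊t / h⌋₊ * h) ((⌊t / h⌋₊ + 1) * h) :=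
  ⟨(le_div_iff₀ hh).1 (Nat.floor_le (div_nonneg ht hh.le)),
    (div_lt_iff₀ hh).1 (Nat.lt_floor_add_one _)⟩

lemma floor_mul_le (hh : 0 < h) (ht : 0 ≤ t) : ⌊t / h⌋₊ * h ≤ t := (mem_Ico_floor_mul hh ht).1

lemma eventually_floor_eq (hh : 0 < h) (ht : 0 ≤ t) :
    ∀ᶠ s in 𝓝[≥] t, ⌊s / h⌋₊ = ⌊t / h⌋₊ := by
  obtain ⟨h₁, h₂⟩ := mem_Ico_floor_mul hh ht
  filter_upwards [Ico_mem_nhdsGE h₂] with s hs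
  exact floor_div_eq hh ⟨h₁.trans hs.1, hs.2⟩

lemma integral_step_of_mem_Icc (hh : 0 < h) (c : ℕ → ℝ) {k : ℕ}
    (ht : t ∈ Icc (k * h) ((k + 1) * h)) :
    ∫ s in (k * h)..t, c ⌊s / h⌋₊ = (t - k * h) * c k := by
  have : ∫ s in (k * h)..t, c ⌊s / h⌋₊ = ∫ _ in (k * h)..t, c k :=
    intervalIntegral.integral_congr_Ioo_of_le ht.1 fun s hs => by
      simp only [floor_div_eq hh ⟨hs.1.le, hs.2.trans_le ht.2⟩]
  simp [this]

lemma sampledIntegral_eq_integral (hh : 0 < h) (y : ℝ → ℝ) (t : ℝ) :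
    sampledIntegral h y t = ∫ s in (0 : ℝ)..t, y (⌊s / h⌋₊ * h) := by
  rcases le_total t 0 with ht | ht
  · have hfloor : ∀ s ≤ 0, ⌊s / h⌋₊ = 0 := fun s hs =>
      Nat.floor_of_nonpos (div_nonpos_of_nonpos_of_nonneg hs hh.le)
    rw [intervalIntegral.integral_congr (g := fun _ => y 0) fun s hs => by
      simp [hfloor s (hs.2.trans (max_le le_rfl ht))]]
    simp [sampledIntegral, hfloor t ht]
  set c : ℕ → ℝ := fun k => y (k * h)
  have hint := (LocBdd.step hh c).intervalIntegrable
  have hgrid : h * ∑ j ∈ Finset.range ⌊t / h⌋₊, c j =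
      ∫ s in (0 : ℝ)..(⌊t / h⌋₊ * h), c ⌊s / h⌋₊ := by
    have := intervalIntegral.sum_integral_adjacent_intervals (a := fun k : ℕ => k * h)
      (n := ⌊t / h⌋₊) fun k _ => hint (k * h) ((k + 1 : ℕ) * h)
    rw [Nat.cast_zero, zero_mul] at this
    rw [← this, Finset.mul_sum]
    refine Finset.sum_congr rfl fun k _ => ?_
    push_cast
    rw [integral_step_of_mem_Icc hh c ⟨by linarith, le_rfl⟩]
    ring
  rw [← intervalIntegral.integral_add_adjacent_intervals (hint 0 (⌊t / h⌋₊ * h)) (hint _ t),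
    integral_step_of_mem_Icc hh c (Ico_subset_Icc_self (mem_Ico_floor_mul hh ht)), ← hgrid,
    add_comm]
  rfl

lemma continuous_sampledIntegral (hh : 0 < h) (y : ℝ → ℝ) : Continuous (sampledIntegral h y) := by
  rw [funext (sampledIntegral_eq_integral hh y)]
  exact intervalIntegral.continuous_primitive
    (LocBdd.step hh fun k => y (k * h)).intervalIntegrable 0

lemma hasDerivWithinAt_sampledIntegral (hh : 0 < h) (y : ℝ → ℝ) (ht : 0 ≤ t) :
    HasDerivWithinAt (sampledIntegral h y) (y (⌊t / h⌋₊ * h)) (Ici t) t := by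
  have hlin : HasDerivWithinAt (fun s => (s - ⌊t / h⌋₊ * h) * y (⌊t / h⌋₊ * h)
      + h * ∑ j ∈ Finset.range ⌊t / h⌋₊, y (j * h)) (1 * y (⌊t / h⌋₊ * h)) (Ici t) t :=
    (((hasDerivAt_id t).sub_const _).mul_const _ |>.add_const _).hasDerivWithinAt
  rw [one_mul] at hlin
  refine hlin.congr_of_eventuallyEq ?_ rfl
  filter_upwards [eventually_floor_eq hh ht] with s hs
  simp only [sampledIntegral, hs]

@[simp]
lemma sampledIntegral_zero (h : ℝ) (y : ℝ → ℝ) : sampledIntegral h y 0 = 0 := by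
  simp [sampledIntegral]

lemma delayedSample_eq {q k : ℕ} (y : ℝ → ℝ) (hk : q ≤ k) :
    delayedSample h q y k = y (k * h - q * h) := by
  rw [delayedSample, if_neg hk.not_gt, Nat.cast_sub hk, sub_mul]

lemma sampledControl_eq (hh : 0 < h) (q : ℕ) (kp ki kd : ℝ) (y : ℝ → ℝ) (k : ℕ) :
    sampledControl h q kp ki kd y k =
      kp * y (k * h) + ki * sampledIntegral h y (k * h) + kd * delayedSample h q y k := by
  simp [sampledControl, sampledIntegral, mul_div_cancel_right₀ _ hh.ne', mul_assoc]

end Grid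

/-! ### The event-triggered control -/

section EventControl

variable {σ : ℝ}

lemma eventControl_sub_sq_le (hσ : 0 ≤ σ) (u : ℕ → ℝ) (k : ℕ) :
    (eventControl σ u k - u k) ^ 2 ≤ σ * u k ^ 2 := by
  cases k with
  | zero => simpa [eventControl] using mul_nonneg hσ (sq_nonneg (u 0))
  | succ k =>
    rw [eventControl]
    split_ifs with h
    · simpa using mul_nonneg hσ (sq_nonneg (u (k + 1)))
    · rw [← neg_sub, neg_sq]
      exact not_lt.1 h

lemma abs_eventControl_sub_le (hσ : 0 ≤ σ) (u : ℕ → ℝ) (k : ℕ) :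
    |eventControl σ u k - u k| ≤ √σ * |u k| := by
  refine abs_le_of_sq_le_sq ?_ (by positivity)
  rw [mul_pow, Real.sq_sqrt hσ, sq_abs]
  exact eventControl_sub_sq_le hσ u k

lemma abs_eventControl_le (hσ : 0 ≤ σ) (hσ1 : σ ≤ 1) (u : ℕ → ℝ) (k : ℕ) :
    |eventControl σ u k| ≤ 2 * |u k| := by
  have herr := (abs_eventControl_sub_le hσ u k).trans
    (mul_le_of_le_one_left (abs_nonneg _) (Real.sqrt_le_one.2 hσ1))
  have htri := abs_sub_abs_le_abs_sub (eventControl σ u k) (u k)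
  linarith

end EventControl

/-! ### Exponential decay in the sup norm -/

section Decay

/-- `DecaysExp` for functions with values in any normed space. The estimates below use the sup
norm of `Fin n → ℝ`, which only changes the constant. -/
def ExpDecay {E : Type*} [NormedAddCommGroup E] (α M : ℝ) (x : ℝ → E) : Prop :=
  ∀ t, 0 ≤ t → ‖x t‖ ≤ M * Real.exp (-α * t) * ‖x 0‖

variable {E F : Type*} [NormedAddCommGroup E] [NormedAddCommGroup F] {α M : ℝ}

lemma ExpDecay.of_norm_le {x : ℝ → E} {z : ℝ → F} {c₁ c₂ : ℝ} (hx : ExpDecay α M x)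
    (hc₁ : 0 ≤ c₁) (h₁ : ∀ t, 0 ≤ t → ‖z t‖ ≤ c₁ * ‖x t‖) (h₂ : ‖x 0‖ ≤ c₂ * ‖z 0‖) :
    ExpDecay α (c₁ * |M| * c₂) z := fun t ht =>
  calc ‖z t‖ ≤ c₁ * (|M| * Real.exp (-α * t) * ‖x 0‖) :=
        (h₁ t ht).trans <| mul_le_mul_of_nonneg_left
          ((hx t ht).trans (by gcongr; exact le_abs_self M)) hc₁
    _ ≤ c₁ * (|M| * Real.exp (-α * t) * (c₂ * ‖z 0‖)) := by gcongr
    _ = c₁ * |M| * c₂ * Real.exp (-α * t) * ‖z 0‖ := by ring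

lemma norm_ofLp_le {n : ℕ} (x : EuclideanSpace ℝ (Fin n)) : ‖x.ofLp‖ ≤ ‖x‖ :=
  (pi_norm_le_iff_of_nonneg (norm_nonneg x)).2 (PiLp.norm_apply_le x)

lemma norm_toLp_le {n : ℕ} (x : Fin n → ℝ) : ‖WithLp.toLp 2 x‖ ≤ √n * ‖x‖ := by
  rw [EuclideanSpace.norm_eq, ← Real.sqrt_sq (norm_nonneg x), ← Real.sqrt_mul n.cast_nonneg]
  have hsum := Finset.sum_le_card_nsmul Finset.univ (fun i => ‖x i‖ ^ 2) (‖x‖ ^ 2)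
    fun i _ => by gcongr; exact norm_le_pi_norm x i
  rw [Finset.card_fin, nsmul_eq_mul] at hsum
  exact Real.sqrt_le_sqrt hsum

lemma ExpDecay.of_decaysExp {n : ℕ} {x : ℝ → Fin n → ℝ}
    (hx : DecaysExp α M fun t => WithLp.toLp 2 (x t)) : ExpDecay α (1 * |M| * √n) x :=
  ExpDecay.of_norm_le hx zero_le_one
    (fun t _ => by simpa using norm_ofLp_le (WithLp.toLp 2 (x t))) (norm_toLp_le _)

lemma ExpDecay.decaysExp {n : ℕ} {x : ℝ → Fin n → ℝ} (hx : ExpDecay α M x) :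
    DecaysExp α (√n * |M| * 1) fun t => WithLp.toLp 2 (x t) :=
  ExpDecay.of_norm_le (z := fun t => WithLp.toLp 2 (x t)) hx (Real.sqrt_nonneg _)
    (fun _ _ => norm_toLp_le _) (by simpa using norm_ofLp_le (WithLp.toLp 2 (x 0)))

/-- The state of plant and controller: `(y, y', x₃)` at time `t`. -/
noncomputable def stateVec (h : ℝ) (y dy : ℝ → ℝ) (t : ℝ) : Fin 3 → ℝ :=
  ![y t, dy t, sampledIntegral h y t]

variable {a₁ a₂ b h kp ki kd σ : ℝ} {q : ℕ}

lemma pidStabilizes_iff : PIDStabilizes a₁ a₂ b kp ki kd α ↔ ∃ M, ∀ y dy,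
    IsPIDSolution a₁ a₂ b kp ki kd y dy → ExpDecay α M fun t => ![y t, dy t] :=
  ⟨fun ⟨_, H⟩ => ⟨_, fun y dy hs => .of_decaysExp (H y dy hs)⟩,
    fun ⟨_, H⟩ => ⟨_, fun y dy hs => (H y dy hs).decaysExp⟩⟩

lemma pidStabilizesFull_iff : PIDStabilizesFull a₁ a₂ b kp ki kd α ↔ ∃ M, ∀ y dy,
    IsPIDSolution a₁ a₂ b kp ki kd y dy →
      ExpDecay α M fun t => ![y t, dy t, ∫ s in (0 : ℝ)..t, y s] :=
  ⟨fun ⟨_, H⟩ => ⟨_, fun y dy hs => .of_decaysExp (H y dy hs)⟩,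
    fun ⟨_, H⟩ => ⟨_, fun y dy hs => (H y dy hs).decaysExp⟩⟩

lemma eventStabilizes_iff : EventStabilizes a₁ a₂ b h q kp ki kd σ α ↔ ∃ M, ∀ y dy,
    IsEventSolution a₁ a₂ b h q kp ki kd σ y dy → ExpDecay α M fun t => ![y t, dy t] :=
  ⟨fun ⟨_, H⟩ => ⟨_, fun y dy hs => .of_decaysExp (H y dy hs)⟩,
    fun ⟨_, H⟩ => ⟨_, fun y dy hs => (H y dy hs).decaysExp⟩⟩

lemma eventStabilizesFull_iff : EventStabilizesFull a₁ a₂ b h q kp ki kd σ α ↔ ∃ M, ∀ y dy,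
    IsEventSolution a₁ a₂ b h q kp ki kd σ y dy → ExpDecay α M (stateVec h y dy) :=
  ⟨fun ⟨_, H⟩ => ⟨_, fun y dy hs => .of_decaysExp (H y dy hs)⟩,
    fun ⟨_, H⟩ => ⟨_, fun y dy hs => (H y dy hs).decaysExp⟩⟩

lemma norm_vec2_le_iff {r x₀ x₁ : ℝ} : ‖![x₀, x₁]‖ ≤ r ↔ |x₀| ≤ r ∧ |x₁| ≤ r := by
  simp [pi_norm_le_iff_of_nonempty]

lemma norm_vec3_le_iff {r x₀ x₁ x₂ : ℝ} :
    ‖![x₀, x₁, x₂]‖ ≤ r ↔ |x₀| ≤ r ∧ |x₁| ≤ r ∧ |x₂| ≤ r := by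
  simp [pi_norm_le_iff_of_nonempty, Fin.forall_fin_succ]

lemma abs_le_norm_stateVec (h : ℝ) (y dy : ℝ → ℝ) (t : ℝ) :
    |y t| ≤ ‖stateVec h y dy t‖ ∧ |dy t| ≤ ‖stateVec h y dy t‖ ∧
      |sampledIntegral h y t| ≤ ‖stateVec h y dy t‖ :=
  norm_vec3_le_iff.1 le_rfl

lemma norm_stateVec_zero (h : ℝ) (y dy : ℝ → ℝ) : ‖stateVec h y dy 0‖ = ‖![y 0, dy 0]‖ := by
  refine eq_of_forall_ge_iff fun r => ?_
  rw [stateVec, norm_vec3_le_iff, norm_vec2_le_iff, sampledIntegral_zero, abs_zero]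
  exact ⟨fun h => ⟨h.1, h.2.1⟩, fun h => ⟨h.1, h.2, (abs_nonneg _).trans h.1⟩⟩

lemma EventStabilizesFull.eventStabilizes (H : EventStabilizesFull a₁ a₂ b h q kp ki kd σ α) :
    EventStabilizes a₁ a₂ b h q kp ki kd σ α := by
  obtain ⟨M, H⟩ := eventStabilizesFull_iff.1 H
  refine eventStabilizes_iff.2 ⟨1 * |M| * 1, fun y dy hs => ?_⟩
  refine (H y dy hs).of_norm_le zero_le_one (fun t _ => ?_) ?_
  · obtain ⟨hy, hdy, -⟩ := abs_le_norm_stateVec h y dy t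
    rw [one_mul]
    exact norm_vec2_le_iff.2 ⟨hy, hdy⟩
  · rw [one_mul, norm_stateVec_zero]

end Decay

/-! ### Solutions of the event-triggered closed loop -/

section Solutions

variable {a₁ a₂ b h kp ki kd σ : ℝ} {q : ℕ} {y dy : ℝ → ℝ}

/-- The right second derivative of a solution, `b û_k - a₁ y' - a₂ y` on `[t_k, t_{k+1})`. -/
noncomputable def eventAccel (a₁ a₂ b h : ℝ) (q : ℕ) (kp ki kd σ : ℝ) (y dy : ℝ → ℝ) (t : ℝ) : ℝ :=
  b * eventControl σ (sampledControl h q kp ki kd y) ⌊t / h⌋₊ - a₁ * dy t - a₂ * y t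

/-- The right derivative of `stateVec` along a solution. -/
noncomputable def stateDeriv (a₁ a₂ b h : ℝ) (q : ℕ) (kp ki kd σ : ℝ) (y dy : ℝ → ℝ) (t : ℝ) :
    Fin 3 → ℝ :=
  ![dy t, eventAccel a₁ a₂ b h q kp ki kd σ y dy t, y (⌊t / h⌋₊ * h)]

lemma sampledControl_congr (hh : 0 ≤ h) {y₁ y₂ : ℝ → ℝ} (hy : EqOn y₁ y₂ (Ici 0)) :
    sampledControl h q kp ki kd y₁ = sampledControl h q kp ki kd y₂ := by
  have hgrid : ∀ j : ℕ, y₁ (j * h) = y₂ (j * h) := fun j => hy (mem_Ici.2 (by positivity))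
  funext k
  simp only [sampledControl, delayedSample, hgrid]

lemma sampledIntegral_congr (hh : 0 ≤ h) {y₁ y₂ : ℝ → ℝ} (hy : EqOn y₁ y₂ (Ici 0)) :
    sampledIntegral h y₁ = sampledIntegral h y₂ := by
  have hgrid : ∀ j : ℕ, y₁ (j * h) = y₂ (j * h) := fun j => hy (mem_Ici.2 (by positivity))
  funext t
  simp only [sampledIntegral, hgrid]

lemma locBdd_eventAccel (hh : 0 < h) (hy : LocBdd y) (hdy : LocBdd dy) :
    LocBdd (eventAccel a₁ a₂ b h q kp ki kd σ y dy) := by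
  have := LocBdd.step hh (eventControl σ (sampledControl h q kp ki kd y))
  unfold eventAccel
  fun_prop

namespace IsEventSolution

lemma congr (hh : 0 < h) {y₂ dy₂ : ℝ → ℝ} (hs : IsEventSolution a₁ a₂ b h q kp ki kd σ y dy)
    (hy : EqOn y₂ y (Ici 0)) (hdy : EqOn dy₂ dy (Ici 0)) :
    IsEventSolution a₁ a₂ b h q kp ki kd σ y₂ dy₂ where
  hasDeriv_y t ht := by
    rw [hdy ht]
    exact (hs.hasDeriv_y t ht).congr hy (hy ht)
  continuousOn_dy := hs.continuousOn_dy.congr hdy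
  hasDeriv_dy k t ht := by
    have hsub : Ico (k * h) ((k + 1) * h) ⊆ Ici 0 := fun s hs => le_trans (by positivity) hs.1
    rw [sampledControl_congr hh.le hy, hdy (hsub ht), hy (hsub ht)]
    exact (hs.hasDeriv_dy k t ht).congr (hdy.mono hsub) (hdy (hsub ht))

lemma continuousOn_y (hs : IsEventSolution a₁ a₂ b h q kp ki kd σ y dy) :
    ContinuousOn y (Ici 0) := fun t ht => (hs.hasDeriv_y t ht).continuousWithinAt

lemma exists_continuous (hh : 0 < h) (hs : IsEventSolution a₁ a₂ b h q kp ki kd σ y dy) :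
    ∃ y₂ dy₂, Continuous y₂ ∧ Continuous dy₂ ∧ IsEventSolution a₁ a₂ b h q kp ki kd σ y₂ dy₂ ∧
      EqOn (stateVec h y₂ dy₂) (stateVec h y dy) (Ici 0) := by
  have hmax : Continuous fun t : ℝ => max t 0 := by fun_prop
  have heq : ∀ f : ℝ → ℝ, EqOn (fun t => f (max t 0)) f (Ici 0) := fun f t ht => by
    simp only [max_eq_left (mem_Ici.1 ht)]
  exact ⟨fun t => y (max t 0), fun t => dy (max t 0),
    hs.continuousOn_y.comp_continuous hmax fun t => le_max_right t 0,
    hs.continuousOn_dy.comp_continuous hmax fun t => le_max_right t 0,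
    hs.congr hh (heq y) (heq dy), fun t ht => by
      simp only [stateVec, sampledIntegral_congr hh.le (heq y), max_eq_left (mem_Ici.1 ht)]⟩

lemma hasDeriv_y_right (hs : IsEventSolution a₁ a₂ b h q kp ki kd σ y dy) {t : ℝ} (ht : 0 ≤ t) :
    HasDerivWithinAt y (dy t) (Ici t) t :=
  (hs.hasDeriv_y t ht).mono (Ici_subset_Ici.2 ht)

lemma hasDeriv_dy_right (hh : 0 < h) (hs : IsEventSolution a₁ a₂ b h q kp ki kd σ y dy) {t : ℝ}
    (ht : 0 ≤ t) : HasDerivWithinAt dy (eventAccel a₁ a₂ b h q kp ki kd σ y dy t) (Ici t) t := by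
  have hm := mem_Ico_floor_mul hh ht
  refine (hs.hasDeriv_dy _ t hm).mono_of_mem_nhdsWithin ?_
  filter_upwards [Ico_mem_nhdsGE hm.2] with s hs
  exact ⟨hm.1.trans hs.1, hs.2⟩

lemma hasDeriv_stateVec (hh : 0 < h) (hs : IsEventSolution a₁ a₂ b h q kp ki kd σ y dy) {t : ℝ}
    (ht : 0 ≤ t) :
    HasDerivWithinAt (stateVec h y dy) (stateDeriv a₁ a₂ b h q kp ki kd σ y dy t) (Ici t) t := by
  refine hasDerivWithinAt_pi.2 fun i => ?_
  fin_cases i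
  exacts [hs.hasDeriv_y_right ht, hs.hasDeriv_dy_right hh ht,
    hasDerivWithinAt_sampledIntegral hh y ht]

lemma continuousOn_stateVec (hh : 0 < h) (hs : IsEventSolution a₁ a₂ b h q kp ki kd σ y dy) :
    ContinuousOn (stateVec h y dy) (Ici 0) := by
  refine continuousOn_pi.2 fun i => ?_
  fin_cases i
  exacts [hs.continuousOn_y, hs.continuousOn_dy, (continuous_sampledIntegral hh y).continuousOn]

end IsEventSolution

/-! ### Growth on bounded time intervals -/

lemma abs_sampledControl_le (hh : 0 < h) {B : ℝ} {k : ℕ} (hy : |y (k * h)| ≤ B)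
    (hz : |ki * sampledIntegral h y (k * h)| ≤ |ki| * B) (hd : |delayedSample h q y k| ≤ B) :
    |sampledControl h q kp ki kd y k| ≤ (|kp| + |ki| + |kd|) * B := by
  rw [sampledControl_eq hh]
  calc _ ≤ |kp * y (k * h)| + |ki * sampledIntegral h y (k * h)| + |kd * delayedSample h q y k| :=
        abs_add_three _ _ _
    _ ≤ |kp| * B + |ki| * B + |kd| * B := by
        rw [abs_mul kp, abs_mul kd]
        gcongr
    _ = (|kp| + |ki| + |kd|) * B := by ring

lemma abs_delayedSample_le (hh : 0 ≤ h) {B : ℝ} {k : ℕ} (hB : 0 ≤ B)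
    (hy : ∀ s ∈ Icc 0 (k * h), |y s| ≤ B) : |delayedSample h q y k| ≤ B := by
  unfold delayedSample
  split_ifs
  · simpa using hB
  · exact hy _ ⟨by positivity, by gcongr; exact Nat.sub_le k q⟩

lemma abs_sampledControl_le_of_stateVec (hh : 0 < h) {B : ℝ} {k : ℕ}
    (hB : ∀ s ∈ Icc 0 (k * h), ‖stateVec h y dy s‖ ≤ B) :
    |sampledControl h q kp ki kd y k| ≤ (|kp| + |ki| + |kd|) * B := by
  have hk : (k : ℝ) * h ∈ Icc 0 (k * h) := ⟨by positivity, le_rfl⟩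
  have hy : ∀ s ∈ Icc 0 (k * h), |y s| ≤ B := fun s hs =>
    (abs_le_norm_stateVec h y dy s).1.trans (hB s hs)
  refine abs_sampledControl_le hh (hy _ hk) ?_
    (abs_delayedSample_le hh.le ((abs_nonneg _).trans (hy _ hk)) hy)
  rw [abs_mul]
  gcongr
  exact (abs_le_norm_stateVec h y dy _).2.2.trans (hB _ hk)

lemma abs_eventAccel_le (hσ : 0 ≤ σ) (hσ1 : σ ≤ 1) (t : ℝ) :
    |eventAccel a₁ a₂ b h q kp ki kd σ y dy t| ≤
      2 * |b| * |sampledControl h q kp ki kd y ⌊t / h⌋₊| + |a₁| * |dy t| + |a₂| * |y t| := by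
  unfold eventAccel
  calc _ ≤ |b * eventControl σ (sampledControl h q kp ki kd y) ⌊t / h⌋₊| + |a₁ * dy t|
          + |a₂ * y t| := (abs_sub _ _).trans (by gcongr; exact abs_sub _ _)
    _ ≤ |b| * (2 * |sampledControl h q kp ki kd y ⌊t / h⌋₊|) + |a₁| * |dy t| + |a₂| * |y t| := by
        simp only [abs_mul]
        gcongr
        exact abs_eventControl_le hσ hσ1 _ _
    _ = _ := by ring

lemma norm_stateDeriv_le (hh : 0 < h) (hσ : 0 ≤ σ) (hσ1 : σ ≤ 1) {B t : ℝ}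
    (hB : ∀ s ∈ Icc 0 (⌊t / h⌋₊ * h), ‖stateVec h y dy s‖ ≤ B) :
    ‖stateDeriv a₁ a₂ b h q kp ki kd σ y dy t‖ ≤ (1 + |a₁| + |a₂|) * ‖stateVec h y dy t‖
      + (1 + 2 * |b| * (|kp| + |ki| + |kd|)) * B := by
  obtain ⟨hy, hdy, -⟩ := abs_le_norm_stateVec h y dy t
  set n := ‖stateVec h y dy t‖
  have hn : 0 ≤ n := (abs_nonneg _).trans hy
  have hsample := hB _ ⟨by positivity, le_rfl⟩
  have hB0 : 0 ≤ B := (norm_nonneg _).trans hsample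
  have hK : 0 ≤ (|a₁| + |a₂|) * n := by positivity
  have hL : 0 ≤ 2 * |b| * (|kp| + |ki| + |kd|) * B := by positivity
  refine norm_vec3_le_iff.2 ⟨by linarith, ?_, ?_⟩
  · calc _ ≤ 2 * |b| * ((|kp| + |ki| + |kd|) * B) + |a₁| * n + |a₂| * n := by
          refine (abs_eventAccel_le hσ hσ1 t).trans ?_
          gcongr
          exact abs_sampledControl_le_of_stateVec hh hB
      _ ≤ _ := by linarith
  · linarith [(abs_le_norm_stateVec h y dy (⌊t / h⌋₊ * h)).1]

lemma gronwallBound_mul {K : ℝ} (hK : K ≠ 0) (ε x δ : ℝ) :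
    gronwallBound δ K (ε * δ) x = gronwallBound 1 K ε x * δ := by
  simp only [gronwallBound_of_K_ne_0 hK]
  ring

theorem exists_norm_stateVec_le (a₁ a₂ b : ℝ) (hh : 0 < h) (q : ℕ) (kp ki kd : ℝ) (hσ : 0 ≤ σ)
    (hσ1 : σ ≤ 1) (N : ℕ) : ∃ C, 0 ≤ C ∧ ∀ y dy : ℝ → ℝ,
      IsEventSolution a₁ a₂ b h q kp ki kd σ y dy →
        ∀ t ∈ Icc 0 (N * h), ‖stateVec h y dy t‖ ≤ C * ‖stateVec h y dy 0‖ := by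
  set K := 1 + |a₁| + |a₂|
  set L := 1 + 2 * |b| * (|kp| + |ki| + |kd|)
  have hK : 0 < K := by positivity
  have hmono : Monotone (gronwallBound 1 K L) :=
    gronwallBound_mono zero_le_one (by positivity) hK.le
  set g := gronwallBound 1 K L h
  have hg : 1 ≤ g := by simpa only [gronwallBound_x0] using hmono hh.le
  refine ⟨g ^ N, by positivity, fun y dy hs => ?_⟩
  set r := ‖stateVec h y dy 0‖
  induction N with
  | zero =>
    intro t ht
    obtain rfl : t = 0 := le_antisymm (by simpa using ht.2) ht.1
    simp [r]
  | succ N ih =>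
    intro t ht
    rcases le_total t (N * h) with htN | htN
    · refine (ih t ⟨ht.1, htN⟩).trans ?_
      gcongr
      exact N.le_succ
    have hN : (0 : ℝ) ≤ N * h := by positivity
    have htN' : t ≤ (N + 1) * h := by simpa using ht.2
    have hsub : Icc (N * h) t ⊆ Ici 0 := fun s hs => hN.trans hs.1
    calc ‖stateVec h y dy t‖ ≤ gronwallBound (g ^ N * r) K (L * (g ^ N * r)) (t - N * h) := by
          refine norm_le_gronwallBound_of_norm_deriv_right_le
            ((hs.continuousOn_stateVec hh).mono hsub)
            (fun s hs' => hs.hasDeriv_stateVec hh (hN.trans hs'.1))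
            (ih _ ⟨hN, le_rfl⟩) (fun s hs' => ?_) t ⟨htN, le_rfl⟩
          refine norm_stateDeriv_le hh hσ hσ1 ?_
          rwa [floor_div_eq hh ⟨hs'.1, hs'.2.trans_le htN'⟩]
      _ = gronwallBound 1 K L (t - N * h) * (g ^ N * r) := gronwallBound_mul hK.ne' _ _ _
      _ ≤ g * (g ^ N * r) := by
          gcongr
          exact hmono (by linarith)
      _ = g ^ (N + 1) * r := by ring

end Solutions

/-! ### Wirtinger's inequality -/

section Wirtinger

variable {f g : ℝ → ℝ} {r s : ℝ}

lemma sq_mul_integral_sq_le {c : ℝ} (hrs : r ≤ s) (hf : ContinuousOn f (Icc r s))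
    (hg : IntervalIntegrable (fun t => g t ^ 2) volume r s)
    (hfg : ∀ t ∈ Ioo r s, HasDerivWithinAt f (g t) (Ioi t) t) (hr : f r = 0) (hc : 0 ≤ c)
    (hcs : c * (s - r) < Real.pi / 2) :
    c ^ 2 * ∫ t in r..s, f t ^ 2 ≤ ∫ t in r..s, g t ^ 2 := by
  have hcos : ∀ t ∈ Icc r s, Real.cos (c * (s - t)) ≠ 0 := by
    intro t ht
    have h₁ : 0 ≤ c * (s - t) := mul_nonneg hc (by linarith [ht.2])
    have h₂ : c * (s - t) ≤ c * (s - r) := mul_le_mul_of_nonneg_left (by linarith [ht.1]) hc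
    exact (Real.cos_pos_of_mem_Ioo ⟨by linarith [Real.pi_pos], by linarith⟩).ne'
  have hf2 : IntervalIntegrable (fun t => c ^ 2 * f t ^ 2) volume r s :=
    ((hf.pow 2).const_smul (c ^ 2)).intervalIntegrable_of_Icc hrs
  have hcont : ContinuousOn (fun t => c * Real.tan (c * (s - t)) * f t ^ 2) (Icc r s) := by
    refine (continuousOn_const.mul fun t ht => ?_).mul (hf.pow 2)
    exact (ContinuousAt.comp (f := fun t => c * (s - t)) (Real.continuousAt_tan.2 (hcos t ht))
      (by fun_prop)).continuousWithinAt
  have hderiv : ∀ t ∈ Ioo r s, HasDerivWithinAt (fun t => c * Real.tan (c * (s - t)) * f t ^ 2)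
      (-c ^ 2 * (1 + Real.tan (c * (s - t)) ^ 2) * f t ^ 2 +
        c * Real.tan (c * (s - t)) * (2 * f t * g t)) (Ioi t) t := by
    intro t ht
    have h₀ := hcos t (Ioo_subset_Icc_self ht)
    have hlin : HasDerivAt (fun t => c * (s - t)) (c * -1) t :=
      ((hasDerivAt_id t).const_sub s).const_mul c
    refine ((((Real.hasDerivAt_tan h₀).comp t hlin).const_mul c).hasDerivWithinAt.mul
      ((hfg t ht).pow 2)).congr_deriv ?_
    rw [← Real.inv_one_add_tan_sq h₀, one_div, inv_inv]
    simp only [Function.comp_apply, Pi.pow_apply, Nat.cast_ofNat, Nat.add_one_sub_one, pow_one]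
    ring
  -- The tangent solves a Riccati equation, so that `g ^ 2 - c ^ 2 * f ^ 2` exceeds this derivative
  -- by the square of `g - c * tan (c * (s - t)) * f`.
  have key := intervalIntegral.sub_le_integral_of_hasDeriv_right_of_le hrs hcont hderiv
    ((intervalIntegrable_iff_integrableOn_Icc_of_le hrs).1 (hg.sub hf2)) fun t _ => by
      nlinarith [sq_nonneg (g t - c * Real.tan (c * (s - t)) * f t)]
  rw [intervalIntegral.integral_sub hg hf2, intervalIntegral.integral_const_mul, hr] at key
  simp only [sub_self, mul_zero, Real.tan_zero, zero_mul, ne_eq, OfNat.ofNat_ne_zero,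
    not_false_eq_true, zero_pow, sub_nonneg] at key
  exact key

lemma wirtinger (hrs : r ≤ s) (hf : ContinuousOn f (Icc r s))
    (hg : IntervalIntegrable (fun t => g t ^ 2) volume r s)
    (hfg : ∀ t ∈ Ioo r s, HasDerivWithinAt f (g t) (Ioi t) t) (hr : f r = 0) :
    Real.pi ^ 2 / 4 * ∫ t in r..s, f t ^ 2 ≤ (s - r) ^ 2 * ∫ t in r..s, g t ^ 2 := by
  rcases hrs.eq_or_lt with rfl | hlt
  · simp
  have : 0 < s - r := sub_pos.2 hlt
  have hlim : Tendsto (fun θ : ℝ => θ ^ 2 * (Real.pi ^ 2 / 4 * ∫ t in r..s, f t ^ 2)) (𝓝[<] 1)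
      (𝓝 (Real.pi ^ 2 / 4 * ∫ t in r..s, f t ^ 2)) :=
    ((Continuous.tendsto' (by fun_prop) 1 _ (by simp)).mono_left nhdsWithin_le_nhds)
  refine le_of_tendsto hlim ?_
  filter_upwards [Ioo_mem_nhdsLT (zero_lt_one (α := ℝ))] with θ hθ
  have hθpi : 0 ≤ θ * Real.pi := mul_nonneg hθ.1.le Real.pi_pos.le
  have key := sq_mul_integral_sq_le (c := θ * Real.pi / (2 * (s - r))) hrs hf hg hfg hr
    (by positivity) (by field_simp; nlinarith [hθ.2, Real.pi_pos])
  calc _ = (s - r) ^ 2 * ((θ * Real.pi / (2 * (s - r))) ^ 2 * ∫ t in r..s, f t ^ 2) := by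
        field_simp
        ring
    _ ≤ _ := mul_le_mul_of_nonneg_left key (sq_nonneg _)

lemma wirtinger_exp {α : ℝ} (hα : 0 ≤ α) (hrs : r ≤ s) (hf : ContinuousOn f (Icc r s))
    (hg : IntervalIntegrable (fun t => g t ^ 2) volume r s)
    (hfg : ∀ t ∈ Ioo r s, HasDerivWithinAt f (g t) (Ioi t) t) (hr : f r = 0) :
    Real.pi ^ 2 / 4 * ∫ t in r..s, Real.exp (2 * α * t) * f t ^ 2 ≤
      (s - r) ^ 2 * Real.exp (2 * α * (s - r)) *
        ∫ t in r..s, Real.exp (2 * α * t) * g t ^ 2 := by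
  have hexp : Continuous fun t => Real.exp (2 * α * t) := by fun_prop
  have hf2 : IntervalIntegrable (fun t => f t ^ 2) volume r s :=
    (hf.pow 2).intervalIntegrable_of_Icc hrs
  have hupper : ∫ t in r..s, Real.exp (2 * α * t) * f t ^ 2 ≤
      Real.exp (2 * α * s) * ∫ t in r..s, f t ^ 2 := by
    rw [← intervalIntegral.integral_const_mul]
    refine intervalIntegral.integral_mono_on hrs (hf2.continuousOn_mul hexp.continuousOn)
      (hf2.const_mul _) fun t ht => ?_
    gcongr
    exact ht.2
  have hlower : Real.exp (2 * α * r) * ∫ t in r..s, g t ^ 2 ≤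
      ∫ t in r..s, Real.exp (2 * α * t) * g t ^ 2 := by
    rw [← intervalIntegral.integral_const_mul]
    refine intervalIntegral.integral_mono_on hrs (hg.const_mul _)
      (hg.continuousOn_mul hexp.continuousOn) fun t ht => ?_
    gcongr
    exact ht.1
  calc _ ≤ Real.pi ^ 2 / 4 * (Real.exp (2 * α * s) * ∫ t in r..s, f t ^ 2) := by gcongr
    _ = Real.exp (2 * α * s) * (Real.pi ^ 2 / 4 * ∫ t in r..s, f t ^ 2) := by ring
    _ ≤ Real.exp (2 * α * s) * ((s - r) ^ 2 * ∫ t in r..s, g t ^ 2) :=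
        mul_le_mul_of_nonneg_left (wirtinger hrs hf hg hfg hr) (Real.exp_pos _).le
    _ = (s - r) ^ 2 * Real.exp (2 * α * (s - r)) *
          (Real.exp (2 * α * r) * ∫ t in r..s, g t ^ 2) := by
        rw [show 2 * α * s = 2 * α * (s - r) + 2 * α * r by ring, Real.exp_add]
        ring
    _ ≤ _ := mul_le_mul_of_nonneg_left hlower (by positivity)

end Wirtinger

lemma integral_le_integral_of_grid {F G : ℝ → ℝ} {h : ℝ} (hh : 0 < h)
    (hF : ∀ r s, IntervalIntegrable F volume r s) (hG : ∀ r s, IntervalIntegrable G volume r s)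
    (hFG : ∀ k : ℕ, ∀ s ∈ Icc (k * h) ((k + 1) * h),
      ∫ t in (k * h)..s, F t ≤ ∫ t in (k * h)..s, G t) {m : ℕ} {T : ℝ} (hT : m * h ≤ T) :
    ∫ t in (m * h)..T, F t ≤ ∫ t in (m * h)..T, G t := by
  set n := ⌊T / h⌋₊
  have hmn : m ≤ n := Nat.le_floor ((le_div_iff₀ hh).2 hT)
  have hsplit : ∀ H : ℝ → ℝ, (∀ r s, IntervalIntegrable H volume r s) →
      ∫ t in (m * h)..T, H t =
        (∑ k ∈ Finset.Ico m n, ∫ t in (k * h)..((k + 1 : ℕ) * h), H t) +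
          ∫ t in (n * h)..T, H t := fun H hH => by
    rw [intervalIntegral.sum_integral_adjacent_intervals_Ico (a := fun k : ℕ => k * h) hmn
      fun k _ => hH _ _, intervalIntegral.integral_add_adjacent_intervals (hH _ _) (hH _ _)]
  rw [hsplit F hF, hsplit G hG]
  refine add_le_add (Finset.sum_le_sum fun k _ => hFG k _ ⟨?_, by push_cast; rfl⟩)
    (hFG n T (Ico_subset_Icc_self (mem_Ico_floor_mul hh (le_trans (by positivity) hT))))
  push_cast
  linarith

lemma integral_sampling_error_le {f g : ℝ → ℝ} {h α : ℝ} (hh : 0 < h) (hα : 0 ≤ α)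
    (hf : Continuous f) (hg : LocBdd g)
    (hfg : ∀ t, 0 ≤ t → HasDerivWithinAt f (g t) (Ici t) t) {m : ℕ} {T : ℝ} (hT : m * h ≤ T) :
    Real.pi ^ 2 / 4 *
        ∫ t in (m * h)..T, Real.exp (2 * α * t) * (f t - f (⌊t / h⌋₊ * h)) ^ 2 ≤
      h ^ 2 * Real.exp (2 * α * h) * ∫ t in (m * h)..T, Real.exp (2 * α * t) * g t ^ 2 := by
  have herr : LocBdd fun t => f t - f (⌊t / h⌋₊ * h) :=
    (LocBdd.of_continuous hf).sub (.step hh fun k => f (k * h))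
  have hexp : LocBdd fun t => Real.exp (2 * α * t) := by fun_prop
  rw [← intervalIntegral.integral_const_mul, ← intervalIntegral.integral_const_mul]
  refine integral_le_integral_of_grid hh
    (((LocBdd.const _).mul (hexp.mul (herr.pow 2))).intervalIntegrable)
    (((LocBdd.const _).mul (hexp.mul (hg.pow 2))).intervalIntegrable) (fun k s hs => ?_) hT
  rw [intervalIntegral.integral_const_mul, intervalIntegral.integral_const_mul]
  have hcongr : ∫ t in (k * h)..s, Real.exp (2 * α * t) * (f t - f (⌊t / h⌋₊ * h)) ^ 2 =
      ∫ t in (k * h)..s, Real.exp (2 * α * t) * (f t - f (k * h)) ^ 2 :=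
    intervalIntegral.integral_congr_Ioo_of_le hs.1 fun t ht => by
      simp only [floor_div_eq hh ⟨ht.1.le, ht.2.trans_le hs.2⟩]
  rw [hcongr]
  have hk : 0 ≤ k * h := by positivity
  have hlen : s - k * h ≤ h := by linarith [hs.2]
  have hlen0 : 0 ≤ s - k * h := by linarith [hs.1]
  refine (wirtinger_exp hα hs.1 (f := fun t => f t - f (k * h)) (by fun_prop)
    ((hg.pow 2).intervalIntegrable _ _)
    (fun t ht => ((hfg t (hk.trans ht.1.le)).mono Ioi_subset_Ici_self).sub_const _)
    (sub_self _)).trans ?_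
  refine mul_le_mul_of_nonneg_right (by gcongr) ?_
  exact intervalIntegral.integral_nonneg hs.1 fun t _ => by positivity

/-! ### The error of replacing the derivative by a finite difference -/

lemma sq_integral_mul_le {w g : ℝ → ℝ} {r s : ℝ} (hrs : r ≤ s) (hw : ∀ t ∈ Icc r s, 0 ≤ w t)
    (hwi : IntervalIntegrable w volume r s)
    (hwg : IntervalIntegrable (fun t => w t * g t) volume r s)
    (hwg2 : IntervalIntegrable (fun t => w t * g t ^ 2) volume r s) :
    (∫ t in r..s, w t * g t) ^ 2 ≤ (∫ t in r..s, w t) * ∫ t in r..s, w t * g t ^ 2 := by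
  have hquad : ∀ x : ℝ, 0 ≤ (∫ t in r..s, w t) * (x * x) + 2 * (∫ t in r..s, w t * g t) * x +
      ∫ t in r..s, w t * g t ^ 2 := by
    intro x
    have hnonneg : 0 ≤ ∫ t in r..s, w t * (x + g t) ^ 2 :=
      intervalIntegral.integral_nonneg hrs fun t ht => mul_nonneg (hw t ht) (sq_nonneg _)
    have hexpand : ∀ t, w t * (x + g t) ^ 2 =
        x * x * w t + 2 * x * (w t * g t) + w t * g t ^ 2 := fun t => by ring
    simp_rw [hexpand] at hnonneg
    rw [intervalIntegral.integral_add ((hwi.const_mul _).add (hwg.const_mul _)) hwg2,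
      intervalIntegral.integral_add (hwi.const_mul _) (hwg.const_mul _),
      intervalIntegral.integral_const_mul, intervalIntegral.integral_const_mul] at hnonneg
    linarith
  have := discrim_le_zero hquad
  rw [discrim] at this
  linarith

lemma integral_sub_left (r s : ℝ) : ∫ t in r..s, (t - r) = (s - r) ^ 2 / 2 := by
  rw [intervalIntegral.integral_comp_sub_right (fun t => t), integral_id]
  ring

section Taylor

variable {y dy g : ℝ → ℝ} {r t : ℝ}

lemma taylor_remainder_eq_integral (hrt : r ≤ t) (hy : ContinuousOn y (Icc r t))
    (hdy : ContinuousOn dy (Icc r t)) (hg : IntervalIntegrable g volume r t)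
    (hyd : ∀ s ∈ Ioo r t, HasDerivWithinAt y (dy s) (Ioi s) s)
    (hdyd : ∀ s ∈ Ioo r t, HasDerivWithinAt dy (g s) (Ioi s) s) :
    y r - y t + (t - r) * dy t = ∫ s in r..t, (s - r) * g s := by
  rw [intervalIntegral.integral_eq_sub_of_hasDeriv_right_of_le
    (f := fun s => (s - r) * dy s - y s) hrt (by fun_prop) (fun s hs => ?_)
    (hg.continuousOn_mul (by fun_prop))]
  · ring
  · refine (((((hasDerivAt_id s).sub_const r).hasDerivWithinAt (s := Ioi s)).mul
      (hdyd s hs)).sub (hyd s hs)).congr_deriv ?_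
    simp

lemma taylor_remainder_sq_le (hrt : r ≤ t) (hy : ContinuousOn y (Icc r t))
    (hdy : ContinuousOn dy (Icc r t)) (hg : IntervalIntegrable g volume r t)
    (hg2 : IntervalIntegrable (fun s => g s ^ 2) volume r t)
    (hyd : ∀ s ∈ Ioo r t, HasDerivWithinAt y (dy s) (Ioi s) s)
    (hdyd : ∀ s ∈ Ioo r t, HasDerivWithinAt dy (g s) (Ioi s) s) :
    (y r - y t + (t - r) * dy t) ^ 2 ≤ (t - r) ^ 2 / 2 * ∫ s in r..t, (s - r) * g s ^ 2 := by
  rw [taylor_remainder_eq_integral hrt hy hdy hg hyd hdyd, ← integral_sub_left]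
  exact sq_integral_mul_le hrt (fun s hs => sub_nonneg.2 hs.1)
    (Continuous.intervalIntegrable (by fun_prop) _ _) (hg.continuousOn_mul (by fun_prop))
    (hg2.continuousOn_mul (by fun_prop))

end Taylor

open scoped Convolution in
lemma integral_le_of_le_convolution {F w G : ℝ → ℝ} {τ T : ℝ} (hτ : 0 ≤ τ) (hT : τ ≤ T)
    (hF : IntervalIntegrable F volume τ T) (hw : IntervalIntegrable w volume 0 τ)
    (hG : IntervalIntegrable G volume 0 T) (hw0 : ∀ p, 0 ≤ p → p ≤ τ → 0 ≤ w p)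
    (hG0 : ∀ t, 0 ≤ G t)
    (hle : ∀ t ∈ Icc τ T, F t ≤ ∫ p in (0 : ℝ)..τ, w p * G (t - p)) :
    ∫ t in τ..T, F t ≤ (∫ p in (0 : ℝ)..τ, w p) * ∫ t in (0 : ℝ)..T, G t := by
  set w₀ : ℝ → ℝ := (Ioc 0 τ).indicator w with hw₀
  set G₀ : ℝ → ℝ := (Icc 0 T).indicator G with hG₀
  have hw₀i : Integrable w₀ :=
    ((intervalIntegrable_iff_integrableOn_Ioc_of_le hτ).1 hw).integrable_indicator
      measurableSet_Ioc
  have hG₀i : Integrable G₀ :=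
    ((intervalIntegrable_iff_integrableOn_Icc_of_le (hτ.trans hT)).1 hG).integrable_indicator
      measurableSet_Icc
  have hconv : Integrable (w₀ ⋆ G₀) := hw₀i.integrable_convolution _ hG₀i
  have hconv0 : ∀ t, 0 ≤ (w₀ ⋆ G₀) t := fun t =>
    integral_nonneg fun p => mul_nonneg
      (indicator_nonneg (fun p hp => hw0 p hp.1.le hp.2) p) (indicator_nonneg (fun t _ => hG0 t) _)
  have hinner : ∀ t ∈ Icc τ T, ∫ p in (0 : ℝ)..τ, w p * G (t - p) = (w₀ ⋆ G₀) t := by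
    intro t ht
    rw [intervalIntegral.integral_of_le hτ, ← integral_indicator measurableSet_Ioc, convolution]
    refine integral_congr_ae (.of_forall fun p => ?_)
    by_cases hp : p ∈ Ioc 0 τ
    · have htp : t - p ∈ Icc 0 T := ⟨by linarith [ht.1, hp.2], by linarith [ht.2, hp.1]⟩
      simp [hw₀, hG₀, hp, htp]
    · simp [hw₀, hp]
  calc ∫ t in τ..T, F t ≤ ∫ t in τ..T, (w₀ ⋆ G₀) t :=
        intervalIntegral.integral_mono_on hT hF hconv.intervalIntegrable fun t ht =>
          (hle t ht).trans_eq (hinner t ht)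
    _ ≤ ∫ t, (w₀ ⋆ G₀) t := by
        rw [intervalIntegral.integral_of_le hT]
        exact setIntegral_le_integral hconv (.of_forall hconv0)
    _ = (∫ p, w₀ p) * ∫ t, G₀ t := by
        rw [integral_convolution _ hw₀i hG₀i]
        rfl
    _ = _ := by
        rw [hw₀, hG₀, integral_indicator measurableSet_Ioc, integral_indicator measurableSet_Icc,
          integral_Icc_eq_integral_Ioc, ← intervalIntegral.integral_of_le hτ,
          ← intervalIntegral.integral_of_le (hτ.trans hT)]

lemma integral_difference_error_le {y dy g : ℝ → ℝ} {τ T α : ℝ} (hτ : 0 ≤ τ) (hT : τ ≤ T)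
    (hα : 0 ≤ α) (hy : Continuous y) (hdy : Continuous dy) (hg : LocBdd g)
    (hyd : ∀ t, 0 ≤ t → HasDerivWithinAt y (dy t) (Ici t) t)
    (hdyd : ∀ t, 0 ≤ t → HasDerivWithinAt dy (g t) (Ici t) t) :
    ∫ t in τ..T, Real.exp (2 * α * t) * (y (t - τ) - y t + τ * dy t) ^ 2 ≤
      τ ^ 4 / 4 * Real.exp (2 * α * τ) * ∫ t in (0 : ℝ)..T, Real.exp (2 * α * t) * g t ^ 2 := by
  have hpoint : ∀ t ∈ Icc τ T, Real.exp (2 * α * t) * (y (t - τ) - y t + τ * dy t) ^ 2 ≤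
      ∫ p in (0 : ℝ)..τ, τ ^ 2 / 2 * Real.exp (2 * α * τ) * (τ - p) *
        (Real.exp (2 * α * (t - p)) * g (t - p) ^ 2) := by
    intro t ht
    have hpos : ∀ s ∈ Ioo (t - τ) t, 0 ≤ s := fun s hs => by linarith [hs.1, ht.1]
    have htaylor := taylor_remainder_sq_le (sub_le_self t hτ) hy.continuousOn hdy.continuousOn
      (hg.intervalIntegrable _ _) ((hg.pow 2).intervalIntegrable _ _)
      (fun s hs => (hyd s (hpos s hs)).mono Ioi_subset_Ici_self)
      (fun s hs => (hdyd s (hpos s hs)).mono Ioi_subset_Ici_self)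
    have hsubst := intervalIntegral.integral_comp_sub_left (a := 0) (b := τ)
      (fun s => (s - (t - τ)) * g s ^ 2) t
    rw [sub_zero] at hsubst
    rw [sub_sub_cancel, ← hsubst] at htaylor
    refine (mul_le_mul_of_nonneg_left htaylor (Real.exp_pos _).le).trans ?_
    rw [← mul_assoc, ← intervalIntegral.integral_const_mul]
    refine intervalIntegral.integral_mono_on hτ (LocBdd.intervalIntegrable (by fun_prop) _ _)
      (LocBdd.intervalIntegrable (by fun_prop) _ _) fun p hp => ?_
    have hexp : Real.exp (2 * α * t) ≤ Real.exp (2 * α * τ) * Real.exp (2 * α * (t - p)) := by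
      rw [← Real.exp_add]
      exact Real.exp_le_exp.2 (by nlinarith [hp.2])
    have hweight : 0 ≤ τ ^ 2 / 2 * ((τ - p) * g (t - p) ^ 2) :=
      mul_nonneg (by positivity) (mul_nonneg (sub_nonneg.2 hp.2) (sq_nonneg _))
    calc _ = Real.exp (2 * α * t) * (τ ^ 2 / 2 * ((τ - p) * g (t - p) ^ 2)) := by ring
      _ ≤ _ := mul_le_mul_of_nonneg_right hexp hweight
      _ = _ := by ring
  refine (integral_le_of_le_convolution (w := fun p => τ ^ 2 / 2 * Real.exp (2 * α * τ) * (τ - p))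
    (G := fun t => Real.exp (2 * α * t) * g t ^ 2) hτ hT
    (Continuous.intervalIntegrable (by fun_prop) _ _)
    (Continuous.intervalIntegrable (by fun_prop) _ _)
    (LocBdd.intervalIntegrable (by fun_prop) _ _)
    (fun p _ hp => mul_nonneg (by positivity) (sub_nonneg.2 hp)) (fun t => by positivity)
    hpoint).trans_eq ?_
  have hramp : ∫ p in (0 : ℝ)..τ, (τ - p) = τ ^ 2 / 2 := by
    rw [intervalIntegral.integral_comp_sub_left (fun p => p)]
    simp [integral_id]
  rw [intervalIntegral.integral_const_mul, hramp]
  ring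

/-! ### Quadratic forms -/

section QuadraticForms

variable {m n k : Type*} [Fintype m] [Fintype n] [Fintype k]

lemma sumElim_dotProduct_fromBlocks_mulVec (A : Matrix m m ℝ) (B : Matrix m n ℝ)
    (D : Matrix n n ℝ) (x : m → ℝ) (y : n → ℝ) :
    Sum.elim x y ⬝ᵥ (Matrix.fromBlocks A B Bᵀ D *ᵥ Sum.elim x y) =
      x ⬝ᵥ (A *ᵥ x) + 2 * (x ⬝ᵥ (B *ᵥ y)) + y ⬝ᵥ (D *ᵥ y) := by
  simp only [Matrix.fromBlocks_mulVec, sumElim_dotProduct_sumElim, Sum.elim_comp_inl,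
    Sum.elim_comp_inr, dotProduct_add, Matrix.dotProduct_transpose_mulVec]
  ring

lemma dotProduct_fromCols_mulVec (B : Matrix m n ℝ) (C : Matrix m k ℝ) (x : m → ℝ) (y : n → ℝ)
    (z : k → ℝ) :
    x ⬝ᵥ (Matrix.fromCols B C *ᵥ Sum.elim y z) = x ⬝ᵥ (B *ᵥ y) + x ⬝ᵥ (C *ᵥ z) := by
  rw [Matrix.fromCols_mulVec_sumElim, dotProduct_add]

lemma mulVec_dotProduct_of_isSymm {P : Matrix n n ℝ} (hP : P.IsSymm) (x y : n → ℝ) :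
    (P *ᵥ x) ⬝ᵥ y = x ⬝ᵥ (P *ᵥ y) := by
  rw [dotProduct_comm, ← Matrix.dotProduct_transpose_mulVec, hP.eq]

lemma hasDerivWithinAt_quadratic {P : Matrix n n ℝ} (hP : P.IsSymm) {x : ℝ → n → ℝ} {w : n → ℝ}
    {s : Set ℝ} {t : ℝ} (hx : HasDerivWithinAt x w s t) :
    HasDerivWithinAt (fun t => x t ⬝ᵥ (P *ᵥ x t)) (2 * (x t ⬝ᵥ (P *ᵥ w))) s t := by
  have hx' := hasDerivWithinAt_pi.1 hx
  have hPx : ∀ i, HasDerivWithinAt (fun t => (P *ᵥ x t) i) ((P *ᵥ w) i) s t := fun i =>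
    HasDerivWithinAt.fun_sum fun j _ => (hx' j).const_mul (P i j)
  refine (HasDerivWithinAt.fun_sum fun i (_ : i ∈ Finset.univ) =>
    (hx' i).mul (hPx i)).congr_deriv ?_
  rw [Finset.sum_add_distrib]
  change w ⬝ᵥ (P *ᵥ x t) + x t ⬝ᵥ (P *ᵥ w) = _
  rw [dotProduct_comm w, mulVec_dotProduct_of_isSymm hP, two_mul]

lemma exists_mul_norm_sq_le_quadratic {P : Matrix n n ℝ} (hP : P.PosDef) :
    ∃ c, 0 < c ∧ ∀ x : n → ℝ, c * ‖x‖ ^ 2 ≤ x ⬝ᵥ (P *ᵥ x) := by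
  rcases isEmpty_or_nonempty n with hn | hn
  · exact ⟨1, one_pos, fun x => by simp [Subsingleton.elim x 0]⟩
  have hcont : Continuous fun x : n → ℝ => x ⬝ᵥ (P *ᵥ x) := by fun_prop
  obtain ⟨z, hz, hmin⟩ := (isCompact_sphere (0 : n → ℝ) 1).exists_isMinOn
    (NormedSpace.sphere_nonempty.2 zero_le_one) hcont.continuousOn
  have hz0 : z ≠ 0 := ne_zero_of_mem_unit_sphere ⟨z, hz⟩
  refine ⟨z ⬝ᵥ (P *ᵥ z), by simpa using hP.dotProduct_mulVec_pos hz0, fun x => ?_⟩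
  rcases eq_or_ne x 0 with rfl | hx
  · simp
  have hxn : ‖x‖ ≠ 0 := norm_ne_zero_iff.2 hx
  have hle : z ⬝ᵥ (P *ᵥ z) ≤ ‖x‖⁻¹ * (‖x‖⁻¹ * (x ⬝ᵥ (P *ᵥ x))) := by
    have hmem : ‖x‖⁻¹ • x ∈ Metric.sphere (0 : n → ℝ) 1 := by simp [norm_smul, hxn]
    simpa [Matrix.mulVec_smul] using hmin hmem
  calc z ⬝ᵥ (P *ᵥ z) * ‖x‖ ^ 2
      ≤ ‖x‖⁻¹ * (‖x‖⁻¹ * (x ⬝ᵥ (P *ᵥ x))) * ‖x‖ ^ 2 := by gcongr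
    _ = x ⬝ᵥ (P *ᵥ x) := by field_simp

lemma quadratic_le_sum_abs_mul_norm_sq (P : Matrix n n ℝ) (x : n → ℝ) :
    x ⬝ᵥ (P *ᵥ x) ≤ (∑ i, ∑ j, |P i j|) * ‖x‖ ^ 2 := by
  simp only [dotProduct, Matrix.mulVec, Finset.mul_sum, Finset.sum_mul]
  refine Finset.sum_le_sum fun i _ => Finset.sum_le_sum fun j _ => ?_
  calc x i * (P i j * x j) ≤ |P i j| * (|x i| * |x j|) := by
        rw [mul_left_comm, ← abs_mul, ← abs_mul]
        exact le_abs_self _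
    _ ≤ |P i j| * ‖x‖ ^ 2 := by
        rw [sq]
        gcongr
        exacts [norm_le_pi_norm x i, norm_le_pi_norm x j]

lemma exists_quadratic_eq_sum_sq {S : Matrix n n ℝ} (hS : S.PosSemidef) :
    ∃ C : Matrix n n ℝ, ∀ x : n → ℝ, x ⬝ᵥ (S *ᵥ x) = ∑ i, (C *ᵥ x) i ^ 2 := by
  classical
  open scoped MatrixOrder in
  obtain ⟨C, rfl⟩ := CStarAlgebra.nonneg_iff_eq_star_mul_self.mp hS.nonneg
  refine ⟨C, fun x => ?_⟩
  have hstar : star C = Cᵀ := rfl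
  rw [hstar, ← Matrix.mulVec_mulVec, Matrix.dotProduct_transpose_mulVec]
  simp only [dotProduct, sq]

end QuadraticForms

/-! ### The quadratic form of the linear matrix inequality -/

section LMIForm

variable {a₁ a₂ b h kp ki kd σ α W R ω : ℝ} {q : ℕ} {P S : Matrix (Fin 3) (Fin 3) ℝ}

/-- The state derivative as the matrix inequality sees it: `A x + √h A_v v + B d`, where `v` is
the scaled sampling error and `d` the sum of the scalar errors entering through the control. -/
noncomputable def lmiDeriv (a₁ a₂ b h : ℝ) (q : ℕ) (kp ki kd : ℝ) (x v : Fin 3 → ℝ) (d : ℝ) :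
    Fin 3 → ℝ :=
  matA a₁ a₂ b h q kp ki kd *ᵥ x + √h • (matAv b kp ki *ᵥ v) + matB b *ᵥ fun _ => d

/-- The sampled control value as the matrix inequality sees it, in the variables of `lmiDeriv`;
the sixth block column of `Ψ` is `ω σ` times its gradient. -/
noncomputable def lmiControl (h : ℝ) (q : ℕ) (kp ki kd : ℝ) (x v : Fin 3 → ℝ) (d : ℝ) : ℝ :=
  (kp + kd) * x 0 - q * h * kd * x 1 + ki * x 2 + √h * (kp * v 0 + ki * v 2) + d

lemma dotProduct_matE_mulVec (x : Fin 3 → ℝ) : x ⬝ᵥ (matE *ᵥ x) = x 1 ^ 2 := by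
  simp [matE, dotProduct, Matrix.mulVec, Fin.sum_univ_three, sq]

lemma dotProduct_matG_mulVec (x : Fin 3 → ℝ) : x ⬝ᵥ (matG h q kd α S R *ᵥ x) =
    h ^ 2 * Real.exp (2 * α * h) * (x ⬝ᵥ (S *ᵥ x)) + R * kd ^ 2 * (q * h) ^ 2 * x 1 ^ 2 := by
  simp only [matG, Matrix.add_mulVec, Matrix.smul_mulVec, dotProduct_add, dotProduct_smul,
    smul_eq_mul, dotProduct_matE_mulVec]

lemma sumElim_dotProduct_matΨ_mulVec (hP : P.IsSymm) (x v w : Fin 3 → ℝ) (δ κ e u : ℝ) :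
    let z : LMIIndex → ℝ := Sum.elim x (Sum.elim v (Sum.elim (fun _ => δ)
      (Sum.elim (fun _ => κ) (Sum.elim (fun _ => e) (Sum.elim (fun _ => u) w)))))
    let g := lmiDeriv a₁ a₂ b h q kp ki kd x v (δ + κ + e)
    let ℓ := lmiControl h q kp ki kd x v (δ + κ)
    z ⬝ᵥ (matΨ a₁ a₂ b h q kp ki kd σ α P S W R ω *ᵥ z) =
      2 * (x ⬝ᵥ (P *ᵥ g)) + 2 * α * (x ⬝ᵥ (P *ᵥ x))
        + W * kd ^ 2 * h ^ 2 * Real.exp (2 * α * h) * x 1 ^ 2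
        - Real.pi ^ 2 / 4 * h * (v ⬝ᵥ (S *ᵥ v))
        - W * (Real.pi ^ 2 / 4) * Real.exp (-2 * α * q * h) * δ ^ 2
        - R * (4 / (q * h) ^ 2) * Real.exp (-2 * α * q * h) * κ ^ 2
        - ω * e ^ 2 + ω * σ * (2 * u * ℓ - u ^ 2)
        + 2 * ((matG h q kd α S R *ᵥ w) ⬝ᵥ g) - w ⬝ᵥ (matG h q kd α S R *ᵥ w) := by
  have hB : (fun _ : Fin 1 => δ + κ + e) = (fun _ => δ) + (fun _ => κ) + fun _ => e := rfl
  have hscalar : ∀ c r s : ℝ, (fun _ : Fin 1 => r) ⬝ᵥ (!![c] *ᵥ fun _ : Fin 1 => s) =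
      c * r * s := fun c r s => by
    simp [dotProduct, Matrix.mulVec, mul_comm, mul_left_comm]
  have hcol : ∀ (c₀ c₁ c₂ : ℝ) (x : Fin 3 → ℝ), x ⬝ᵥ (!![c₀; c₁; c₂] *ᵥ fun _ : Fin 1 => u) =
      (c₀ * x 0 + c₁ * x 1 + c₂ * x 2) * u := fun c₀ c₁ c₂ x => by
    simp only [dotProduct, Matrix.mulVec, Fin.sum_univ_three, Finset.univ_unique,
      Finset.sum_singleton, Matrix.of_apply, Matrix.cons_val, Fin.default_eq_zero]
    ring
  unfold matΨ lmiDeriv lmiControl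
  simp only [sumElim_dotProduct_fromBlocks_mulVec, dotProduct_fromCols_mulVec, Matrix.add_mulVec,
    Matrix.mulVec_add, Matrix.mulVec_smul, Matrix.smul_mulVec, ← Matrix.mulVec_mulVec,
    dotProduct_add, dotProduct_smul, smul_eq_mul, Matrix.zero_mulVec, dotProduct_zero,
    Matrix.neg_mulVec, dotProduct_neg, Matrix.dotProduct_transpose_mulVec,
    mulVec_dotProduct_of_isSymm hP, dotProduct_matE_mulVec, hscalar, hcol, hB]
  ring

-- The last two blocks of `Ψ` come from Schur complements; evaluating the form at `u = ℓ`, `w = g`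
-- undoes them.
lemma lmi_quadratic_le (hP : P.IsSymm)
    (hΨ : (-(matΨ a₁ a₂ b h q kp ki kd σ α P S W R ω)).PosSemidef) (x v : Fin 3 → ℝ)
    (δ κ e : ℝ) :
    let g := lmiDeriv a₁ a₂ b h q kp ki kd x v (δ + κ + e)
    2 * (x ⬝ᵥ (P *ᵥ g)) + 2 * α * (x ⬝ᵥ (P *ᵥ x))
        + W * kd ^ 2 * h ^ 2 * Real.exp (2 * α * h) * x 1 ^ 2
        + h ^ 2 * Real.exp (2 * α * h) * (g ⬝ᵥ (S *ᵥ g)) + R * kd ^ 2 * (q * h) ^ 2 * g 1 ^ 2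
        + ω * σ * lmiControl h q kp ki kd x v (δ + κ) ^ 2 ≤
      Real.pi ^ 2 / 4 * h * (v ⬝ᵥ (S *ᵥ v))
        + W * (Real.pi ^ 2 / 4) * Real.exp (-2 * α * q * h) * δ ^ 2
        + R * (4 / (q * h) ^ 2) * Real.exp (-2 * α * q * h) * κ ^ 2 + ω * e ^ 2 := by
  intro g
  set ℓ := lmiControl h q kp ki kd x v (δ + κ)
  have hform := sumElim_dotProduct_matΨ_mulVec (a₁ := a₁) (a₂ := a₂) (b := b) (h := h) (q := q)
    (kp := kp) (ki := ki) (kd := kd) (σ := σ) (α := α) (W := W) (R := R) (ω := ω) (S := S)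
    hP x v g δ κ e ℓ
  have hnonneg := hΨ.dotProduct_mulVec_nonneg (Sum.elim x (Sum.elim v (Sum.elim (fun _ => δ)
    (Sum.elim (fun _ => κ) (Sum.elim (fun _ => e) (Sum.elim (fun _ => ℓ) g))))))
  rw [star_trivial, Matrix.neg_mulVec, dotProduct_neg, hform] at hnonneg
  rw [dotProduct_comm (matG h q kd α S R *ᵥ g), dotProduct_matG_mulVec] at hnonneg
  linarith

end LMIForm

section Dissipation

variable {a₁ a₂ b h kp ki kd σ α W R ω : ℝ} {q : ℕ} {P S : Matrix (Fin 3) (Fin 3) ℝ}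
  {y dy : ℝ → ℝ} {t : ℝ}

lemma lmiControl_add (x v : Fin 3 → ℝ) (d e : ℝ) :
    lmiControl h q kp ki kd x v (d + e) = lmiControl h q kp ki kd x v d + e := by
  simp only [lmiControl, add_assoc]

lemma lmiDeriv_eq (x v : Fin 3 → ℝ) (d : ℝ) :
    lmiDeriv a₁ a₂ b h q kp ki kd x v d =
      ![x 1, b * lmiControl h q kp ki kd x v d - a₁ * x 1 - a₂ * x 0, x 0 + √h * v 0] := by
  funext i
  fin_cases i <;>
    simp [lmiDeriv, lmiControl, matA, matAv, matB, dotProduct, Fin.sum_univ_three]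
  ring

/-- The scaled sampling error, the vector `v` of `lmiDeriv`. -/
noncomputable def samplingError (h : ℝ) (y dy : ℝ → ℝ) (t : ℝ) : Fin 3 → ℝ :=
  -(√h)⁻¹ • (stateVec h y dy t - stateVec h y dy (⌊t / h⌋₊ * h))

lemma sqrt_mul_samplingError (hh : 0 < h) (y dy : ℝ → ℝ) (t : ℝ) (i : Fin 3) :
    √h * samplingError h y dy t i = stateVec h y dy (⌊t / h⌋₊ * h) i - stateVec h y dy t i := by
  have := Real.sqrt_ne_zero'.2 hh
  simp only [samplingError, Pi.smul_apply, Pi.sub_apply, smul_eq_mul]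
  field_simp
  ring

lemma mul_samplingError_quadratic (hh : 0 < h) (y dy : ℝ → ℝ) (t : ℝ) :
    h * (samplingError h y dy t ⬝ᵥ (S *ᵥ samplingError h y dy t)) =
      (stateVec h y dy t - stateVec h y dy (⌊t / h⌋₊ * h)) ⬝ᵥ
        (S *ᵥ (stateVec h y dy t - stateVec h y dy (⌊t / h⌋₊ * h))) := by
  have hsq : √h ^ 2 = h := Real.sq_sqrt hh.le
  have := Real.sqrt_ne_zero'.2 hh
  simp only [samplingError, Matrix.mulVec_smul, dotProduct_smul, smul_dotProduct, smul_eq_mul]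
  field_simp
  rw [hsq]

lemma sampledControl_eq_lmiControl (hh : 0 < h) (y dy : ℝ → ℝ) (ht : q * h ≤ t) :
    sampledControl h q kp ki kd y ⌊t / h⌋₊ =
      lmiControl h q kp ki kd (stateVec h y dy t) (samplingError h y dy t)
        (kd * (y (⌊t / h⌋₊ * h - q * h) - y t + q * h * dy t)) := by
  have hk : q ≤ ⌊t / h⌋₊ := Nat.le_floor ((le_div_iff₀ hh).2 ht)
  have h₀ := sqrt_mul_samplingError hh y dy t 0
  have h₂ := sqrt_mul_samplingError hh y dy t 2
  rw [sampledControl_eq hh, delayedSample_eq y hk]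
  simp only [lmiControl, stateVec, Matrix.cons_val] at h₀ h₂ ⊢
  linear_combination -kp * h₀ - ki * h₂

lemma stateDeriv_eq_lmiDeriv (hh : 0 < h) (y dy : ℝ → ℝ) (ht : q * h ≤ t) :
    stateDeriv a₁ a₂ b h q kp ki kd σ y dy t =
      lmiDeriv a₁ a₂ b h q kp ki kd (stateVec h y dy t) (samplingError h y dy t)
        (kd * (y (⌊t / h⌋₊ * h - q * h) - y t + q * h * dy t) +
          (eventControl σ (sampledControl h q kp ki kd y) ⌊t / h⌋₊ -
            sampledControl h q kp ki kd y ⌊t / h⌋₊)) := by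
  rw [lmiDeriv_eq, lmiControl_add, ← sampledControl_eq_lmiControl hh y dy ht, add_sub_cancel,
    sqrt_mul_samplingError hh]
  simp [stateDeriv, stateVec, eventAccel]

lemma dissipation_le (hh : 0 < h) (hσ : 0 ≤ σ) (hω : 0 ≤ ω) (hP : P.IsSymm)
    (hΨ : (-(matΨ a₁ a₂ b h q kp ki kd σ α P S W R ω)).PosSemidef) (y dy : ℝ → ℝ)
    (ht : q * h ≤ t) :
    let x := stateVec h y dy t
    let w := stateDeriv a₁ a₂ b h q kp ki kd σ y dy t
    let d := x - stateVec h y dy (⌊t / h⌋₊ * h)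
    2 * (x ⬝ᵥ (P *ᵥ w)) + 2 * α * (x ⬝ᵥ (P *ᵥ x)) ≤
      (Real.pi ^ 2 / 4 * (d ⬝ᵥ (S *ᵥ d)) - h ^ 2 * Real.exp (2 * α * h) * (w ⬝ᵥ (S *ᵥ w)))
      + W * kd ^ 2 * (Real.pi ^ 2 / 4 * Real.exp (-2 * α * (q * h)) *
          (y (t - q * h) - y (⌊t / h⌋₊ * h - q * h)) ^ 2
        - h ^ 2 * Real.exp (2 * α * h) * dy t ^ 2)
      + R * kd ^ 2 * (4 / (q * h) ^ 2 * Real.exp (-2 * α * (q * h)) *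
          (y (t - q * h) - y t + q * h * dy t) ^ 2
        - (q * h) ^ 2 * eventAccel a₁ a₂ b h q kp ki kd σ y dy t ^ 2) := by
  intro x w d
  have hform := lmi_quadratic_le hP hΨ x (samplingError h y dy t)
    (kd * (y (⌊t / h⌋₊ * h - q * h) - y (t - q * h)))
    (kd * (y (t - q * h) - y t + q * h * dy t))
    (eventControl σ (sampledControl h q kp ki kd y) ⌊t / h⌋₊ -
      sampledControl h q kp ki kd y ⌊t / h⌋₊)
  have hsum : kd * (y (⌊t / h⌋₊ * h - q * h) - y (t - q * h)) +
      kd * (y (t - q * h) - y t + q * h * dy t) =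
      kd * (y (⌊t / h⌋₊ * h - q * h) - y t + q * h * dy t) := by ring
  have hexp : -2 * α * q * h = -2 * α * (q * h) := by ring
  have hevent := mul_le_mul_of_nonneg_left
    (eventControl_sub_sq_le hσ (sampledControl h q kp ki kd y) ⌊t / h⌋₊) hω
  simp only [hsum, hexp] at hform
  rw [← stateDeriv_eq_lmiDeriv hh y dy ht, ← sampledControl_eq_lmiControl hh y dy ht,
    mul_assoc (Real.pi ^ 2 / 4), mul_samplingError_quadratic hh] at hform
  change _ + W * kd ^ 2 * h ^ 2 * _ * dy t ^ 2 + _ +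
    R * kd ^ 2 * _ * eventAccel a₁ a₂ b h q kp ki kd σ y dy t ^ 2 + _ ≤ _ at hform
  linarith

end Dissipation

/-! ### The Lyapunov–Krasovskii estimate -/

section LyapunovIntegrals

variable {n : Type*} [Fintype n] {α h τ T : ℝ}

lemma LocBdd.mulVec {m : Type*} (Q : Matrix m n ℝ) {f : ℝ → n → ℝ}
    (hf : ∀ j, LocBdd fun t => f t j) (i : m) : LocBdd fun t => (Q *ᵥ f t) i :=
  LocBdd.sum fun j _ => (LocBdd.const (Q i j)).mul (hf j)

lemma LocBdd.quadratic (Q : Matrix n n ℝ) {f : ℝ → n → ℝ} (hf : ∀ i, LocBdd fun t => f t i) :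
    LocBdd fun t => f t ⬝ᵥ (Q *ᵥ f t) :=
  LocBdd.sum fun i _ => (hf i).mul (LocBdd.mulVec Q hf i)

lemma integral_quadratic_sampling_error_le {S : Matrix n n ℝ} (hS : S.PosSemidef) (hh : 0 < h)
    (hα : 0 ≤ α) {x w : ℝ → n → ℝ} (hx : Continuous x) (hw : ∀ i, LocBdd fun t => w t i)
    (hxw : ∀ t, 0 ≤ t → HasDerivWithinAt x (w t) (Ici t) t) {m : ℕ} (hT : m * h ≤ T) :
    Real.pi ^ 2 / 4 * ∫ t in (m * h)..T, Real.exp (2 * α * t) *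
        ((x t - x (⌊t / h⌋₊ * h)) ⬝ᵥ (S *ᵥ (x t - x (⌊t / h⌋₊ * h)))) ≤
      h ^ 2 * Real.exp (2 * α * h) *
        ∫ t in (m * h)..T, Real.exp (2 * α * t) * (w t ⬝ᵥ (S *ᵥ w t)) := by
  obtain ⟨C, hC⟩ := exists_quadratic_eq_sum_sq hS
  have hexp : LocBdd fun t => Real.exp (2 * α * t) := by fun_prop
  have hCx : ∀ i, Continuous fun t => (C *ᵥ x t) i := fun i => by fun_prop
  have hCw : ∀ i, LocBdd fun t => (C *ᵥ w t) i := LocBdd.mulVec C hw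
  have hCxw : ∀ i t, 0 ≤ t → HasDerivWithinAt (fun t => (C *ᵥ x t) i) ((C *ᵥ w t) i) (Ici t) t :=
    fun i t ht => HasDerivWithinAt.fun_sum fun j _ =>
      (hasDerivWithinAt_pi.1 (hxw t ht) j).const_mul _
  have herr : ∀ i, LocBdd fun t => Real.exp (2 * α * t) *
      ((C *ᵥ x t) i - (C *ᵥ x (⌊t / h⌋₊ * h)) i) ^ 2 := fun i =>
    hexp.mul (((LocBdd.of_continuous (hCx i)).sub
      (LocBdd.step hh fun k => (C *ᵥ x (k * h)) i)).pow 2)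
  simp only [hC]
  simp only [Matrix.mulVec_sub, Pi.sub_apply, Finset.mul_sum]
  rw [intervalIntegral.integral_finsetSum fun i _ => (herr i).intervalIntegrable _ _,
    intervalIntegral.integral_finsetSum
      fun i _ => (hexp.mul ((hCw i).pow 2)).intervalIntegrable _ _, Finset.mul_sum, Finset.mul_sum]
  exact Finset.sum_le_sum fun i _ => integral_sampling_error_le hh hα (hCx i) (hCw i) (hCxw i) hT

lemma integral_delayed_sampling_error_le {y dy : ℝ → ℝ} {q : ℕ} (hh : 0 < h) (hα : 0 ≤ α)
    (hy : Continuous y) (hdy : LocBdd dy)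
    (hyd : ∀ t, 0 ≤ t → HasDerivWithinAt y (dy t) (Ici t) t) (hT : q * h ≤ T) :
    Real.pi ^ 2 / 4 * Real.exp (-2 * α * (q * h)) * ∫ t in (q * h)..T, Real.exp (2 * α * t) *
        (y (t - q * h) - y (⌊t / h⌋₊ * h - q * h)) ^ 2 ≤
      h ^ 2 * Real.exp (2 * α * h) * ∫ t in (0 : ℝ)..T, Real.exp (2 * α * t) * dy t ^ 2 := by
  have hshift : Real.exp (-2 * α * (q * h)) * ∫ t in (q * h)..T, Real.exp (2 * α * t) *
        (y (t - q * h) - y (⌊t / h⌋₊ * h - q * h)) ^ 2 =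
      ∫ t in (0 : ℝ)..(T - q * h), Real.exp (2 * α * t) * (y t - y (⌊t / h⌋₊ * h)) ^ 2 := by
    have hsub := intervalIntegral.integral_comp_sub_right (a := q * h) (b := T) (fun t =>
      Real.exp (2 * α * t) * (y t - y (⌊t / h⌋₊ * h)) ^ 2) (q * h)
    rw [sub_self] at hsub
    rw [← hsub, ← intervalIntegral.integral_const_mul]
    refine intervalIntegral.integral_congr fun t ht => ?_
    rw [uIcc_of_le hT] at ht
    have hk : q ≤ ⌊t / h⌋₊ := Nat.le_floor ((le_div_iff₀ hh).2 ht.1)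
    have hfloor : ⌊(t - q * h) / h⌋₊ * h = (⌊t / h⌋₊ * h - q * h : ℝ) := by
      rw [sub_div, mul_div_cancel_right₀ _ hh.ne', Nat.floor_sub_natCast, Nat.cast_sub hk, sub_mul]
    simp only [hfloor]
    rw [← mul_assoc, ← Real.exp_add]
    ring_nf
  have hsampling := integral_sampling_error_le hh hα hy hdy hyd (m := 0) (T := T - q * h)
    (by simpa using hT)
  rw [Nat.cast_zero, zero_mul] at hsampling
  have hmono : ∫ t in (0 : ℝ)..(T - q * h), Real.exp (2 * α * t) * dy t ^ 2 ≤
      ∫ t in (0 : ℝ)..T, Real.exp (2 * α * t) * dy t ^ 2 :=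
    intervalIntegral.integral_mono_interval le_rfl (by linarith)
      (sub_le_self _ (by positivity)) (.of_forall fun t => by positivity)
      (LocBdd.intervalIntegrable (by fun_prop) _ _)
  rw [mul_assoc, hshift]
  exact hsampling.trans (by gcongr)

lemma integral_exp_mul_sub_le {J I : ℝ → ℝ} {a c r : ℝ} (hJ : LocBdd J) (hI : LocBdd I)
    (hJI : a * ∫ t in τ..T, Real.exp (2 * α * t) * J t ≤
      c * ∫ t in r..T, Real.exp (2 * α * t) * I t) :
    ∫ t in τ..T, Real.exp (2 * α * t) * (a * J t - c * I t) ≤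
      c * ∫ t in r..τ, Real.exp (2 * α * t) * I t := by
  have hEJ : LocBdd fun t => Real.exp (2 * α * t) * J t := by fun_prop
  have hEI : LocBdd fun t => Real.exp (2 * α * t) * I t := by fun_prop
  rw [← intervalIntegral.integral_add_adjacent_intervals (hEI.intervalIntegrable r τ)
    (hEI.intervalIntegrable τ T)] at hJI
  simp only [mul_sub, mul_left_comm _ a, mul_left_comm _ c]
  rw [intervalIntegral.integral_sub ((hEJ.intervalIntegrable τ T).const_mul a)
    ((hEI.intervalIntegrable τ T).const_mul c), intervalIntegral.integral_const_mul,
    intervalIntegral.integral_const_mul]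
  linarith

lemma integral_exp_mul_add_le {D₁ D₂ : ℝ → ℝ} {B₁ B₂ c : ℝ} (hc : 0 ≤ c) (hD₁ : LocBdd D₁)
    (hD₂ : LocBdd D₂) (h₁ : ∫ t in τ..T, Real.exp (2 * α * t) * D₁ t ≤ B₁)
    (h₂ : ∫ t in τ..T, Real.exp (2 * α * t) * D₂ t ≤ B₂) :
    ∫ t in τ..T, Real.exp (2 * α * t) * (D₁ t + c * D₂ t) ≤ B₁ + c * B₂ := by
  simp only [mul_add, mul_left_comm _ c]
  rw [intervalIntegral.integral_add (LocBdd.intervalIntegrable (by fun_prop) _ _)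
    (LocBdd.intervalIntegrable (by fun_prop) _ _), intervalIntegral.integral_const_mul]
  gcongr

lemma exp_mul_quadratic_le {P : Matrix n n ℝ} (hP : P.IsSymm) {x w : ℝ → n → ℝ}
    (hx : Continuous x) (hτ : 0 ≤ τ) (hτT : τ ≤ T)
    (hxw : ∀ t, 0 ≤ t → HasDerivWithinAt x (w t) (Ici t) t) {D : ℝ → ℝ} (hD : LocBdd D)
    (hle : ∀ t, τ ≤ t → 2 * (x t ⬝ᵥ (P *ᵥ w t)) + 2 * α * (x t ⬝ᵥ (P *ᵥ x t)) ≤ D t) :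
    Real.exp (2 * α * T) * (x T ⬝ᵥ (P *ᵥ x T)) ≤
      Real.exp (2 * α * τ) * (x τ ⬝ᵥ (P *ᵥ x τ)) + ∫ t in τ..T, Real.exp (2 * α * t) * D t := by
  rw [← sub_le_iff_le_add']
  refine intervalIntegral.sub_le_integral_of_hasDeriv_right_of_le
    (g := fun t => Real.exp (2 * α * t) * (x t ⬝ᵥ (P *ᵥ x t))) hτT (by fun_prop)
    (fun t ht => ?_) ((intervalIntegrable_iff_integrableOn_Icc_of_le hτT).1
      (LocBdd.intervalIntegrable (by fun_prop) τ T)) fun t ht =>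
      mul_le_mul_of_nonneg_left (hle t ht.1.le) (Real.exp_pos (2 * α * t)).le
  have hexp : HasDerivAt (fun t => Real.exp (2 * α * t)) (Real.exp (2 * α * t) * (2 * α)) t := by
    simpa using ((hasDerivAt_id t).const_mul (2 * α)).exp
  have hderiv := hexp.hasDerivWithinAt.mul
    (hasDerivWithinAt_quadratic hP (hxw t (hτ.trans ht.1.le)))
  exact (hderiv.congr_deriv (by ring)).mono Ioi_subset_Ici_self

lemma integral_exp_mul_sq_le {f : ℝ → ℝ} {D : ℝ} (hα : 0 ≤ α) (hτ : 0 ≤ τ)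
    (hf : ∀ t ∈ Icc 0 τ, |f t| ≤ D) :
    ∫ t in (0 : ℝ)..τ, Real.exp (2 * α * t) * f t ^ 2 ≤ Real.exp (2 * α * τ) * τ * D ^ 2 := by
  have hbound := intervalIntegral.norm_integral_le_of_norm_le_const (a := 0) (b := τ)
    (f := fun t => Real.exp (2 * α * t) * f t ^ 2) (C := Real.exp (2 * α * τ) * D ^ 2)
    fun t ht => by
      rw [uIoc_of_le hτ] at ht
      rw [Real.norm_of_nonneg (by positivity), ← sq_abs (f t)]
      gcongr
      exacts [ht.2, hf t (Ioc_subset_Icc_self ht)]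
  rw [sub_zero, abs_of_nonneg hτ, mul_right_comm] at hbound
  exact (le_abs_self _).trans hbound

end LyapunovIntegrals

section LMI

variable {a₁ a₂ b h kp ki kd σ α W R ω : ℝ} {q : ℕ} {P S : Matrix (Fin 3) (Fin 3) ℝ}
  {y dy : ℝ → ℝ}

lemma continuous_stateVec (hh : 0 < h) (hy : Continuous y) (hdy : Continuous dy) :
    Continuous (stateVec h y dy) := by
  refine continuous_pi fun i => ?_
  fin_cases i
  exacts [hy, hdy, continuous_sampledIntegral hh y]

lemma locBdd_stateDeriv (hh : 0 < h) (hy : LocBdd y) (hdy : LocBdd dy) (i : Fin 3) :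
    LocBdd fun t => stateDeriv a₁ a₂ b h q kp ki kd σ y dy t i := by
  fin_cases i
  exacts [hdy, locBdd_eventAccel hh hy hdy, .step hh fun k => y (k * h)]

lemma integral_scaled_difference_error_le {g : ℝ → ℝ} {τ T : ℝ} (hτ : 0 < τ) (hT : τ ≤ T)
    (hα : 0 ≤ α) (hy : Continuous y) (hdy : Continuous dy) (hg : LocBdd g)
    (hyd : ∀ t, 0 ≤ t → HasDerivWithinAt y (dy t) (Ici t) t)
    (hdyd : ∀ t, 0 ≤ t → HasDerivWithinAt dy (g t) (Ici t) t) :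
    4 / τ ^ 2 * Real.exp (-2 * α * τ) *
        ∫ t in τ..T, Real.exp (2 * α * t) * (y (t - τ) - y t + τ * dy t) ^ 2 ≤
      τ ^ 2 * ∫ t in (0 : ℝ)..T, Real.exp (2 * α * t) * g t ^ 2 := by
  have hexp : Real.exp (-2 * α * τ) * Real.exp (2 * α * τ) = 1 := by
    rw [← Real.exp_add, ← Real.exp_zero]
    ring_nf
  calc 4 / τ ^ 2 * Real.exp (-2 * α * τ) *
        ∫ t in τ..T, Real.exp (2 * α * t) * (y (t - τ) - y t + τ * dy t) ^ 2
      ≤ 4 / τ ^ 2 * Real.exp (-2 * α * τ) * (τ ^ 4 / 4 * Real.exp (2 * α * τ) *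
          ∫ t in (0 : ℝ)..T, Real.exp (2 * α * t) * g t ^ 2) := by
        gcongr
        exact integral_difference_error_le hτ.le hT hα hy hdy hg hyd hdyd
    _ = τ ^ 2 * (Real.exp (-2 * α * τ) * Real.exp (2 * α * τ)) *
          ∫ t in (0 : ℝ)..T, Real.exp (2 * α * t) * g t ^ 2 := by
        field_simp
    _ = τ ^ 2 * ∫ t in (0 : ℝ)..T, Real.exp (2 * α * t) * g t ^ 2 := by rw [hexp, mul_one]

theorem lyapunov_le (hh : 0 < h) (hq : 0 < q) (hα : 0 ≤ α) (hσ : 0 ≤ σ) (hW : 0 ≤ W) (hR : 0 ≤ R)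
    (hω : 0 ≤ ω) (hP : P.IsSymm) (hS : S.PosSemidef)
    (hΨ : (-(matΨ a₁ a₂ b h q kp ki kd σ α P S W R ω)).PosSemidef)
    (hy : Continuous y) (hdy : Continuous dy)
    (hs : IsEventSolution a₁ a₂ b h q kp ki kd σ y dy) {T : ℝ} (hT : q * h ≤ T) :
    Real.exp (2 * α * T) * (stateVec h y dy T ⬝ᵥ (P *ᵥ stateVec h y dy T)) ≤
      Real.exp (2 * α * (q * h)) * (stateVec h y dy (q * h) ⬝ᵥ (P *ᵥ stateVec h y dy (q * h)))
      + W * kd ^ 2 * (h ^ 2 * Real.exp (2 * α * h) *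
          ∫ t in (0 : ℝ)..(q * h), Real.exp (2 * α * t) * dy t ^ 2)
      + R * kd ^ 2 * ((q * h) ^ 2 * ∫ t in (0 : ℝ)..(q * h), Real.exp (2 * α * t) *
          eventAccel a₁ a₂ b h q kp ki kd σ y dy t ^ 2) := by
  have hacc : LocBdd (eventAccel a₁ a₂ b h q kp ki kd σ y dy) :=
    locBdd_eventAccel hh (.of_continuous hy) (.of_continuous hdy)
  have hw := locBdd_stateDeriv (a₁ := a₁) (a₂ := a₂) (b := b) (q := q) (kp := kp) (ki := ki)
    (kd := kd) (σ := σ) hh (.of_continuous hy) (.of_continuous hdy)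
  have hx := continuous_stateVec hh hy hdy
  have hxw := fun t ht => hs.hasDeriv_stateVec hh (t := t) ht
  set x := stateVec h y dy
  set w := stateDeriv a₁ a₂ b h q kp ki kd σ y dy
  have hd : ∀ i, LocBdd fun t => (x t - x (⌊t / h⌋₊ * h)) i := fun i =>
    (LocBdd.of_continuous (by fun_prop)).sub (.step hh fun k => x (k * h) i)
  have hdS := LocBdd.quadratic S hd
  have hwS := LocBdd.quadratic S hw
  have hdy2 := (LocBdd.of_continuous hdy).pow 2
  have hacc2 := hacc.pow 2
  have hdel : LocBdd fun t => (y (t - q * h) - y (⌊t / h⌋₊ * h - q * h)) ^ 2 :=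
    ((LocBdd.of_continuous (by fun_prop)).sub (.step hh fun k => y (k * h - q * h))).pow 2
  have hrem : LocBdd fun t => (y (t - q * h) - y t + q * h * dy t) ^ 2 :=
    .of_continuous (by fun_prop)
  have hstate := integral_exp_mul_sub_le hdS hwS
    (integral_quadratic_sampling_error_le hS hh hα hx hw hxw hT)
  have hdelay := integral_exp_mul_sub_le hdel hdy2
    (integral_delayed_sampling_error_le hh hα hy (.of_continuous hdy)
      (fun t ht => hs.hasDeriv_y_right ht) hT)
  have hdiff := integral_exp_mul_sub_le hrem hacc2
    (integral_scaled_difference_error_le (by positivity) hT hα hy hdy hacc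
      (fun t ht => hs.hasDeriv_y_right ht) (fun t ht => hs.hasDeriv_dy_right hh ht))
  rw [intervalIntegral.integral_same, mul_zero] at hstate
  have hD₁ := ((LocBdd.const (Real.pi ^ 2 / 4)).mul hdS).sub
    ((LocBdd.const (h ^ 2 * Real.exp (2 * α * h))).mul hwS)
  have hD₂ := ((LocBdd.const (Real.pi ^ 2 / 4 * Real.exp (-2 * α * (q * h)))).mul hdel).sub
    ((LocBdd.const (h ^ 2 * Real.exp (2 * α * h))).mul hdy2)
  have hD₃ := ((LocBdd.const (4 / (q * h) ^ 2 * Real.exp (-2 * α * (q * h)))).mul hrem).sub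
    ((LocBdd.const ((q * h : ℝ) ^ 2)).mul hacc2)
  have hD₁₂ := hD₁.add ((LocBdd.const (W * kd ^ 2)).mul hD₂)
  have hsum := integral_exp_mul_add_le (c := R * kd ^ 2) (by positivity) hD₁₂ hD₃
    (integral_exp_mul_add_le (by positivity) hD₁ hD₂ hstate hdelay) hdiff
  have hV := exp_mul_quadratic_le hP hx (by positivity) hT hxw
    (hD₁₂.add ((LocBdd.const (R * kd ^ 2)).mul hD₃))
    fun t _ => dissipation_le hh hσ hω hP hΨ y dy ‹_›
  linarith

lemma exists_abs_eventAccel_le (a₁ a₂ b : ℝ) (hh : 0 < h) (q : ℕ) (kp ki kd : ℝ) (hσ : 0 ≤ σ)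
    (hσ1 : σ ≤ 1) (N : ℕ) :
    ∃ C, 0 ≤ C ∧ ∀ y dy, IsEventSolution a₁ a₂ b h q kp ki kd σ y dy → ∀ t ∈ Icc 0 (N * h),
      |eventAccel a₁ a₂ b h q kp ki kd σ y dy t| ≤ C * ‖stateVec h y dy 0‖ := by
  obtain ⟨C, hC, hstate⟩ := exists_norm_stateVec_le a₁ a₂ b hh q kp ki kd hσ hσ1 N
  refine ⟨(1 + |a₁| + |a₂|) * C + (1 + 2 * |b| * (|kp| + |ki| + |kd|)) * C, by positivity,
    fun y dy hs t ht => ?_⟩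
  have hle_t : ⌊t / h⌋₊ * h ≤ t := floor_mul_le hh ht.1
  calc |eventAccel a₁ a₂ b h q kp ki kd σ y dy t|
      ≤ ‖stateDeriv a₁ a₂ b h q kp ki kd σ y dy t‖ :=
        norm_le_pi_norm (stateDeriv a₁ a₂ b h q kp ki kd σ y dy t) 1
    _ ≤ (1 + |a₁| + |a₂|) * ‖stateVec h y dy t‖ +
          (1 + 2 * |b| * (|kp| + |ki| + |kd|)) * (C * ‖stateVec h y dy 0‖) :=
        norm_stateDeriv_le hh hσ hσ1 fun s hs' =>
          hstate y dy hs s ⟨hs'.1, hs'.2.trans (hle_t.trans ht.2)⟩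
    _ ≤ (1 + |a₁| + |a₂|) * (C * ‖stateVec h y dy 0‖) +
          (1 + 2 * |b| * (|kp| + |ki| + |kd|)) * (C * ‖stateVec h y dy 0‖) := by
        gcongr
        exact hstate y dy hs t ht
    _ = _ := by ring

lemma exists_exp_mul_quadratic_le (hh : 0 < h) (hq : 0 < q) (hα : 0 ≤ α) (hσ : 0 ≤ σ) (hσ1 : σ ≤ 1)
    (hW : 0 ≤ W) (hR : 0 ≤ R) (hω : 0 ≤ ω) (hP : P.IsSymm) (hS : S.PosSemidef)
    (hΨ : (-(matΨ a₁ a₂ b h q kp ki kd σ α P S W R ω)).PosSemidef) :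
    ∃ K, 0 ≤ K ∧ ∀ y dy, Continuous y → Continuous dy →
      IsEventSolution a₁ a₂ b h q kp ki kd σ y dy → ∀ T, q * h ≤ T →
        Real.exp (2 * α * T) * (stateVec h y dy T ⬝ᵥ (P *ᵥ stateVec h y dy T)) ≤
          K * ‖stateVec h y dy 0‖ ^ 2 := by
  obtain ⟨C, -, hstate⟩ := exists_norm_stateVec_le a₁ a₂ b hh q kp ki kd hσ hσ1 q
  obtain ⟨D, -, hacc⟩ := exists_abs_eventAccel_le a₁ a₂ b hh q kp ki kd hσ hσ1 q
  have hqh : 0 ≤ q * h := by positivity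
  refine ⟨Real.exp (2 * α * (q * h)) * ((∑ i, ∑ j, |P i j|) * C ^ 2)
    + W * kd ^ 2 * (h ^ 2 * Real.exp (2 * α * h) * (Real.exp (2 * α * (q * h)) * (q * h) * C ^ 2))
    + R * kd ^ 2 * ((q * h) ^ 2 * (Real.exp (2 * α * (q * h)) * (q * h) * D ^ 2)),
    by positivity, fun y dy hy hdy hs T hT => ?_⟩
  have hdy_le : ∀ t ∈ Icc 0 (q * h), |dy t| ≤ C * ‖stateVec h y dy 0‖ := fun t ht =>
    (abs_le_norm_stateVec h y dy t).2.1.trans (hstate y dy hs t ht)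
  have hquad : stateVec h y dy (q * h) ⬝ᵥ (P *ᵥ stateVec h y dy (q * h)) ≤
      (∑ i, ∑ j, |P i j|) * (C * ‖stateVec h y dy 0‖) ^ 2 := by
    refine (quadratic_le_sum_abs_mul_norm_sq P _).trans ?_
    gcongr
    exact hstate y dy hs _ ⟨hqh, le_rfl⟩
  refine (lyapunov_le hh hq hα hσ hW hR hω hP hS hΨ hy hdy hs hT).trans ?_
  grw [hquad, integral_exp_mul_sq_le hα hqh hdy_le,
    integral_exp_mul_sq_le hα hqh (hacc y dy hs)]
  exact le_of_eq (by ring)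

lemma norm_le_of_exp_mul_quadratic_le {n : Type*} [Fintype n] {P : Matrix n n ℝ} {x : n → ℝ}
    {c K r T : ℝ} (hc : 0 < c) (hK : 0 ≤ K) (hr : 0 ≤ r) (hcx : c * ‖x‖ ^ 2 ≤ x ⬝ᵥ (P *ᵥ x))
    (hx : Real.exp (2 * α * T) * (x ⬝ᵥ (P *ᵥ x)) ≤ K * r ^ 2) :
    ‖x‖ ≤ √(K / c) * Real.exp (-α * T) * r := by
  refine abs_le_of_sq_le_sq' ?_ (by positivity) |>.2
  have hexp : Real.exp (-α * T) ^ 2 * Real.exp (2 * α * T) = 1 := by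
    rw [← Real.exp_nat_mul, ← Real.exp_add, ← Real.exp_zero]
    push_cast
    ring_nf
  have hcK : Real.exp (2 * α * T) * (c * ‖x‖ ^ 2) ≤ K * r ^ 2 := by grw [hcx, hx]
  rw [mul_pow, mul_pow, Real.sq_sqrt (by positivity), div_mul_eq_mul_div, div_mul_eq_mul_div,
    le_div_iff₀ hc]
  calc ‖x‖ ^ 2 * c = Real.exp (-α * T) ^ 2 * (Real.exp (2 * α * T) * (c * ‖x‖ ^ 2)) := by
        linear_combination -(‖x‖ ^ 2 * c) * hexp
    _ ≤ Real.exp (-α * T) ^ 2 * (K * r ^ 2) := by gcongr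
    _ = K * Real.exp (-α * T) ^ 2 * r ^ 2 := by ring

theorem eventStabilizesFull_of_LMIFeasible (hh : 0 < h) (hq : 0 < q) (hσ : 0 ≤ σ) (hσ1 : σ ≤ 1)
    (hα : 0 ≤ α) (hL : LMIFeasible a₁ a₂ b h q kp ki kd σ α) :
    EventStabilizesFull a₁ a₂ b h q kp ki kd σ α := by
  obtain ⟨P, S, W, R, ω, hP, hS, hW, hR, hω, hΨ⟩ := hL
  have hPsymm : P.IsSymm := Matrix.isHermitian_iff_isSymm.1 hP.1
  obtain ⟨C, hC, hstate⟩ := exists_norm_stateVec_le a₁ a₂ b hh q kp ki kd hσ hσ1 q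
  obtain ⟨c, hc, hcoercive⟩ := exists_mul_norm_sq_le_quadratic hP
  obtain ⟨K, hK, hquad⟩ :=
    exists_exp_mul_quadratic_le hh hq hα hσ hσ1 hW hR hω hPsymm hS.posSemidef hΨ
  refine eventStabilizesFull_iff.2 ⟨√(K / c) + C * Real.exp (α * (q * h)), fun y dy hs t ht => ?_⟩
  obtain ⟨y₂, dy₂, hy₂, hdy₂, hs₂, heq⟩ := hs.exists_continuous hh
  rw [← heq ht, ← heq self_mem_Ici, add_mul, add_mul]
  rcases le_total t (q * h) with hle | hge
  · have hexp : 1 ≤ Real.exp (α * (q * h)) * Real.exp (-α * t) := by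
      rw [← Real.exp_add]
      exact Real.one_le_exp (by nlinarith)
    calc ‖stateVec h y₂ dy₂ t‖ ≤ C * ‖stateVec h y₂ dy₂ 0‖ := hstate y₂ dy₂ hs₂ t ⟨ht, hle⟩
      _ ≤ C * ‖stateVec h y₂ dy₂ 0‖ * (Real.exp (α * (q * h)) * Real.exp (-α * t)) :=
        le_mul_of_one_le_right (by positivity) hexp
      _ = C * Real.exp (α * (q * h)) * Real.exp (-α * t) * ‖stateVec h y₂ dy₂ 0‖ := by ring
      _ ≤ _ := le_add_of_nonneg_left (by positivity)
  · exact (norm_le_of_exp_mul_quadratic_le hc hK (norm_nonneg _) (hcoercive _)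
      (hquad y₂ dy₂ hy₂ hdy₂ hs₂ t hge)).trans (le_add_of_nonneg_right (by positivity))

end LMI

/-! ### Perturbations of exponentially stable linear systems -/

section SmallGain

lemma exists_forall_norm_le_mul_exp {E : Type*} [SeminormedAddCommGroup E] {X : ℝ → E}
    {T : ℝ} (α : ℝ) (hT : 0 ≤ T) (hX : ContinuousOn X (Icc 0 T)) :
    ∃ s ∈ Icc 0 T, ∀ r ∈ Icc 0 T, ‖X r‖ ≤ Real.exp (α * s) * ‖X s‖ * Real.exp (-α * r) := by
  have hcont : ContinuousOn (fun s => Real.exp (α * s) * ‖X s‖) (Icc 0 T) :=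
    ContinuousOn.mul (by fun_prop) hX.norm
  obtain ⟨s, hs, hmax⟩ := isCompact_Icc.exists_isMaxOn (nonempty_Icc.2 hT) hcont
  refine ⟨s, hs, fun r hr => ?_⟩
  calc ‖X r‖ = Real.exp (α * r + -α * r) * ‖X r‖ := by
        rw [neg_mul, add_neg_cancel, Real.exp_zero, one_mul]
    _ = Real.exp (α * r) * ‖X r‖ * Real.exp (-α * r) := by rw [Real.exp_add]; ring
    _ ≤ Real.exp (α * s) * ‖X s‖ * Real.exp (-α * r) := by gcongr ?_ * _; exact hmax hr

variable {E : Type*} [NormedAddCommGroup E] [NormedSpace ℝ E] {A : E →L[ℝ] E} {M α β : ℝ}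

/-- The semigroup `e^{tA}` generated by `A` decays with constant `M` and rate `β`. -/
def SemigroupDecays (A : E →L[ℝ] E) (M β : ℝ) : Prop :=
  ∀ t : ℝ, 0 ≤ t → ∀ v : E, ‖NormedSpace.exp (t • A) v‖ ≤ M * Real.exp (-β * t) * ‖v‖

lemma SemigroupDecays.norm_exp_sub_smul_apply_le {η t T : ℝ} {v : E}
    (hA : SemigroupDecays A M β) (hM : 0 ≤ M) (ht : t ≤ T)
    (hv : ‖v‖ ≤ η * Real.exp (-α * t)) :
    ‖NormedSpace.exp ((T - t) • A) v‖ ≤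
      M * η * Real.exp (-β * T) * Real.exp ((β - α) * t) :=
  calc ‖NormedSpace.exp ((T - t) • A) v‖
    _ ≤ M * Real.exp (-β * (T - t)) * ‖v‖ := hA (T - t) (sub_nonneg.2 ht) v
    _ ≤ M * Real.exp (-β * (T - t)) * (η * Real.exp (-α * t)) := by gcongr
    _ = M * η * Real.exp (-β * (T - t) + -α * t) := by rw [Real.exp_add]; ring
    _ = M * η * Real.exp (-β * T) * Real.exp ((β - α) * t) := by
        rw [mul_assoc _ (Real.exp _), ← Real.exp_add]; ring_nf

lemma exp_smul_apply_comm (A : E →L[ℝ] E) (v : E) (t : ℝ) :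
    NormedSpace.exp (t • A) (A v) = A (NormedSpace.exp (t • A) v) :=
  congrArg (fun L : E →L[ℝ] E => L v) ((Commute.refl A).smul_left t).exp_left.eq

variable [CompleteSpace E]

lemma hasDerivAt_exp_smul_apply (A : E →L[ℝ] E) (v : E) (t : ℝ) :
    HasDerivAt (fun t : ℝ => NormedSpace.exp (t • A) v) (A (NormedSpace.exp (t • A) v)) t :=
  ((hasDerivAt_exp_smul_const' A t).clm_apply (hasDerivAt_const t v)).congr_deriv (by simp)

lemma hasDerivAt_exp_sub_smul (A : E →L[ℝ] E) (T t : ℝ) :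
    HasDerivAt (fun s : ℝ => NormedSpace.exp ((T - s) • A))
      (-(NormedSpace.exp ((T - t) • A) * A)) t :=
  ((hasDerivAt_exp_smul_const A (T - t)).scomp t ((hasDerivAt_id t).const_sub T)).congr_deriv
    (by simp)

/- Variation of constants in differential form: `s ↦ e^{(T-s)A} X(s)` has derivative
`e^{(T-s)A} d(s)`. -/
lemma norm_le_of_perturbed_linear {η t₀ T : ℝ} (hM : 0 ≤ M) (hη : 0 ≤ η) (hαβ : α < β)
    (hA : SemigroupDecays A M β) (hT : t₀ ≤ T) {X d : ℝ → E} (hX : ContinuousOn X (Icc t₀ T))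
    (hX' : ∀ t ∈ Ico t₀ T, HasDerivWithinAt X (A (X t) + d t) (Ici t) t)
    (hd : ∀ t ∈ Ico t₀ T, ‖d t‖ ≤ η * Real.exp (-α * t)) :
    ‖X T‖ ≤ M * Real.exp (-β * (T - t₀)) * ‖X t₀‖ + M * η / (β - α) * Real.exp (-α * T) := by
  have hδ : 0 < β - α := sub_pos.2 hαβ
  set c := M * η / (β - α) * Real.exp (-β * T) with hc
  have hc0 : 0 ≤ c * Real.exp ((β - α) * t₀) := by rw [hc]; positivity
  have hBound : ∀ s, HasDerivAt (fun s => ‖NormedSpace.exp ((T - t₀) • A) (X t₀)‖ +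
      c * (Real.exp ((β - α) * s) - Real.exp ((β - α) * t₀)))
      (M * η * Real.exp (-β * T) * Real.exp ((β - α) * s)) s := by
    intro s
    have hexp := ((hasDerivAt_id s).const_mul (β - α)).exp
    refine (((hexp.sub_const _).const_mul c).const_add _).congr_deriv ?_
    rw [hc, id]
    field_simp
  have key := image_norm_le_of_norm_deriv_right_le_deriv_boundary
    (f := fun s => NormedSpace.exp ((T - s) • A) (X s))
    (f' := fun s => NormedSpace.exp ((T - s) • A) (d s))
    (ContinuousOn.clm_apply
      (fun t _ => (hasDerivAt_exp_sub_smul A T t).continuousAt.continuousWithinAt) hX)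
    (fun t ht => ((hasDerivAt_exp_sub_smul A T t).hasDerivWithinAt.clm_apply
      (hX' t ht)).congr_deriv (by simp))
    (by simp) hBound
    (fun t ht => hA.norm_exp_sub_smul_apply_le hM ht.2.le (hd t ht)) (right_mem_Icc.2 hT)
  simp only [sub_self, zero_smul, NormedSpace.exp_zero, one_apply_eq_self] at key
  calc ‖X T‖
    _ ≤ ‖NormedSpace.exp ((T - t₀) • A) (X t₀)‖ + c * Real.exp ((β - α) * T) := by linarith
    _ ≤ M * Real.exp (-β * (T - t₀)) * ‖X t₀‖ + c * Real.exp ((β - α) * T) := by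
        gcongr
        exact hA _ (sub_nonneg.2 hT) _
    _ = M * Real.exp (-β * (T - t₀)) * ‖X t₀‖ +
          M * η / (β - α) * Real.exp (-β * T + (β - α) * T) := by rw [hc, Real.exp_add]; ring
    _ = _ := by ring_nf

/- The perturbation `d` may depend on the whole past of `X`. With `Z` the maximum of
`e^{αs} ‖X s‖` on `[0, T]`, variation of constants bounds `Z` by the initial data plus `Z / 2`. -/
theorem norm_le_of_small_gain {ε t₀ D : ℝ} (hM : 0 ≤ M) (hα : 0 ≤ α) (hαβ : α < β)
    (hA : SemigroupDecays A M β) (hε : 0 ≤ ε) (hMε : M * ε / (β - α) ≤ 1 / 2) (ht₀ : 0 ≤ t₀)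
    {X d : ℝ → E} (hX : ContinuousOn X (Ici 0))
    (hX' : ∀ t, t₀ ≤ t → HasDerivWithinAt X (A (X t) + d t) (Ici t) t)
    (hd : ∀ T Z : ℝ, 0 ≤ Z → (∀ s ∈ Icc 0 T, ‖X s‖ ≤ Z * Real.exp (-α * s)) →
      ∀ t ∈ Icc t₀ T, ‖d t‖ ≤ ε * Z * Real.exp (-α * t))
    (hD : ∀ s ∈ Icc 0 t₀, ‖X s‖ ≤ D) {T : ℝ} (hT : 0 ≤ T) :
    ‖X T‖ ≤ (2 * M + 1) * Real.exp (α * t₀) * D * Real.exp (-α * T) := by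
  have hD0 : 0 ≤ D := (norm_nonneg _).trans (hD 0 (left_mem_Icc.2 ht₀))
  obtain ⟨s, hs, hmax⟩ :=
    exists_forall_norm_le_mul_exp α hT (hX.mono Icc_subset_Ici_self)
  set Z := Real.exp (α * s) * ‖X s‖ with hZ
  have hZ0 : 0 ≤ Z := by positivity
  suffices hbound : Z ≤ (2 * M + 1) * Real.exp (α * t₀) * D from
    (hmax T (right_mem_Icc.2 hT)).trans (by gcongr)
  have hMD : 0 ≤ M * (Real.exp (α * t₀) * D) := by positivity
  rcases le_total s t₀ with hst | hst
  · have hZD : Z ≤ Real.exp (α * t₀) * D := by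
      rw [hZ]; gcongr; exact hD s ⟨hs.1, hst⟩
    linarith
  have hXs := norm_le_of_perturbed_linear (α := α) (η := ε * Z) hM (by positivity) hαβ hA hst
    (hX.mono fun r hr => ht₀.trans hr.1) (fun t ht => hX' t ht.1)
    (fun t ht => hd T Z hZ0 hmax t ⟨ht.1, ht.2.le.trans hs.2⟩)
  have hshift : Real.exp (α * s) * Real.exp (-β * (s - t₀)) ≤ Real.exp (α * t₀) := by
    rw [← Real.exp_add]
    gcongr
    nlinarith
  have hcancel : Real.exp (α * s) * Real.exp (-α * s) = 1 := by
    rw [← Real.exp_add, neg_mul, add_neg_cancel, Real.exp_zero]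
  have hself : Z ≤ M * (Real.exp (α * t₀) * D) + 1 / 2 * Z :=
    calc Z ≤ Real.exp (α * s) * (M * Real.exp (-β * (s - t₀)) * ‖X t₀‖ +
          M * (ε * Z) / (β - α) * Real.exp (-α * s)) := by rw [hZ]; gcongr
      _ = M * (Real.exp (α * s) * Real.exp (-β * (s - t₀)) * ‖X t₀‖) +
          M * ε / (β - α) * Z * (Real.exp (α * s) * Real.exp (-α * s)) := by ring
      _ ≤ M * (Real.exp (α * t₀) * D) + 1 / 2 * Z := by
          rw [hcancel, mul_one]
          gcongr M * ?_ + ?_ * Z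
          gcongr
          exact hD t₀ (right_mem_Icc.2 ht₀)
  have : 0 ≤ Real.exp (α * t₀) * D := by positivity
  linarith

end SmallGain

/-! ### The continuous closed loop -/

section Continuous

variable {a₁ a₂ b kp ki kd β : ℝ} {y dy : ℝ → ℝ}

lemma IsPIDSolution.continuousOn_y (hs : IsPIDSolution a₁ a₂ b kp ki kd y dy) :
    ContinuousOn y (Ici 0) := fun t ht => (hs.hasDeriv_y t ht).continuousWithinAt

lemma IsPIDSolution.continuousOn_dy (hs : IsPIDSolution a₁ a₂ b kp ki kd y dy) :
    ContinuousOn dy (Ici 0) := fun t ht => (hs.hasDeriv_dy t ht).continuousWithinAt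

lemma IsPIDSolution.abs_integral_sub_le {N s t : ℝ} (hs : IsPIDSolution a₁ a₂ b kp ki kd y dy)
    (ht : 0 ≤ t) (hst : t ≤ s) (hy : ∀ r ∈ Icc t s, |y r| ≤ N) :
    |(∫ r in (0 : ℝ)..s, y r) - ∫ r in (0 : ℝ)..t, y r| ≤ N * (s - t) := by
  have hint : ∀ p, 0 ≤ p → IntervalIntegrable y volume 0 p := fun p hp =>
    (hs.continuousOn_y.mono fun r hr => (le_min le_rfl hp).trans hr.1).intervalIntegrable
  rw [intervalIntegral.integral_interval_sub_left (hint s (ht.trans hst)) (hint t ht),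
    ← abs_of_nonneg (sub_nonneg.2 hst)]
  refine intervalIntegral.norm_integral_le_of_norm_le_const (f := y) fun r hr => ?_
  rw [uIoc_of_le hst] at hr
  exact hy r ⟨hr.1.le, hr.2⟩

/- By the mean value theorem `y''` is of order `N` somewhere in `[t, t + 1]`; there the equation
expresses the integral by `y''`, `y'` and `y`. -/
lemma IsPIDSolution.abs_mul_abs_integral_le {N t : ℝ}
    (hs : IsPIDSolution a₁ a₂ b kp ki kd y dy) (ht : 0 ≤ t)
    (hy : ∀ s ∈ Icc t (t + 1), |y s| ≤ N) (hdy : ∀ s ∈ Icc t (t + 1), |dy s| ≤ N) :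
    |b * ki| * |∫ s in (0 : ℝ)..t, y s| ≤
      (2 + |b * kp - a₂| + |b * kd - a₁| + |b * ki|) * N := by
  obtain ⟨s, hst, hslope⟩ := exists_hasDerivAt_eq_slope dy _ (lt_add_one t)
    (hs.continuousOn_dy.mono fun r hr => ht.trans hr.1)
    fun r hr => (hs.hasDeriv_dy r (ht.trans hr.1.le)).hasDerivAt (Ici_mem_nhds (ht.trans_lt hr.1))
  have hsI : s ∈ Icc t (t + 1) := Ioo_subset_Icc_self hst
  have hN : 0 ≤ N := (abs_nonneg _).trans (hy s hsI)
  have hdiff : |(∫ r in (0 : ℝ)..s, y r) - ∫ r in (0 : ℝ)..t, y r| ≤ N :=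
    (hs.abs_integral_sub_le ht hsI.1 fun r hr => hy r ⟨hr.1, hr.2.trans hsI.2⟩).trans
      (mul_le_of_le_one_right hN (by linarith [hsI.2]))
  rw [add_sub_cancel_left, div_one, pidControl] at hslope
  have hint : b * ki * (∫ r in (0 : ℝ)..t, y r) =
      dy (t + 1) - dy t - (b * kp - a₂) * y s - (b * kd - a₁) * dy s -
        b * ki * ((∫ r in (0 : ℝ)..s, y r) - ∫ r in (0 : ℝ)..t, y r) := by
    linear_combination hslope
  have hdy₁ : |dy (t + 1)| ≤ N := hdy (t + 1) (right_mem_Icc.2 (by linarith))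
  have hdy₀ : |dy t| ≤ N := hdy t (left_mem_Icc.2 (by linarith))
  have hys := hy s hsI
  have hdys := hdy s hsI
  rw [← abs_mul, hint]
  grw [abs_sub, abs_sub, abs_sub, abs_sub, abs_mul, abs_mul, abs_mul, hdy₁, hdy₀, hys, hdys, hdiff]
  linarith

theorem PIDStabilizes.pidStabilizesFull (hb : b * ki ≠ 0) (hβ : 0 ≤ β)
    (H : PIDStabilizes a₁ a₂ b kp ki kd β) : PIDStabilizesFull a₁ a₂ b kp ki kd β := by
  rw [pidStabilizes_iff] at H
  rw [pidStabilizesFull_iff]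
  obtain ⟨M, hM⟩ := H
  have hbk : 0 < |b * ki| := abs_pos.2 hb
  set c := 2 + |b * kp - a₂| + |b * kd - a₁| + |b * ki|
  have hc : 0 ≤ c / |b * ki| := by positivity
  refine ⟨(1 + c / |b * ki|) * |M|, fun y dy hs t ht => ?_⟩
  set N := |M| * Real.exp (-β * t) * ‖![y 0, dy 0]‖ with hN
  have hdecay : ∀ s, t ≤ s → |y s| ≤ N ∧ |dy s| ≤ N := fun s hts => by
    refine norm_vec2_le_iff.1 ((hM y dy hs s (ht.trans hts)).trans ?_)
    have hexp : Real.exp (-β * s) ≤ Real.exp (-β * t) :=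
      Real.exp_le_exp.2 (mul_le_mul_of_nonpos_left hts (neg_nonpos.2 hβ))
    rw [hN]
    gcongr
    exact le_abs_self M
  have hint : |∫ s in (0 : ℝ)..t, y s| ≤ c / |b * ki| * N := by
    rw [div_mul_eq_mul_div, le_div_iff₀' hbk]
    exact hs.abs_mul_abs_integral_le ht (fun s hst => (hdecay s hst.1).1)
      fun s hst => (hdecay s hst.1).2
  have hN0 : 0 ≤ N := by positivity
  have hcN : 0 ≤ c / |b * ki| * N := mul_nonneg hc hN0
  have h0 : ‖![y 0, dy 0]‖ ≤ ‖![y 0, dy 0, ∫ s in (0 : ℝ)..0, y s]‖ :=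
    norm_vec2_le_iff.2 ⟨norm_le_pi_norm ![y 0, dy 0, ∫ s in (0 : ℝ)..0, y s] 0,
      norm_le_pi_norm ![y 0, dy 0, ∫ s in (0 : ℝ)..0, y s] 1⟩
  calc ‖![y t, dy t, ∫ s in (0 : ℝ)..t, y s]‖
    _ ≤ (1 + c / |b * ki|) * N :=
        norm_vec3_le_iff.2 ⟨by linarith [(hdecay t le_rfl).1], by linarith [(hdecay t le_rfl).2],
          by linarith⟩
    _ = (1 + c / |b * ki|) * |M| * Real.exp (-β * t) * ‖![y 0, dy 0]‖ := by rw [hN]; ring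
    _ ≤ _ := by gcongr

/-- The generator of the plant under PD control, for the state `(y, y')`. -/
noncomputable def pdGenerator (a₁ a₂ b kp kd : ℝ) : (Fin 2 → ℝ) →L[ℝ] (Fin 2 → ℝ) :=
  LinearMap.toContinuousLinearMap
    (Matrix.toLin' !![0, 1; b * kp - a₂, b * kd - a₁])

/-- The generator of the plant and the integrator under PID control, for the state
`(y, y', ∫ y)`. -/
noncomputable def pidGenerator (a₁ a₂ b kp ki kd : ℝ) : (Fin 3 → ℝ) →L[ℝ] (Fin 3 → ℝ) :=
  LinearMap.toContinuousLinearMap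
    (Matrix.toLin' !![0, 1, 0; b * kp - a₂, b * kd - a₁, b * ki; 1, 0, 0])

lemma pdGenerator_apply (v : Fin 2 → ℝ) : pdGenerator a₁ a₂ b kp kd v =
    ![v 1, (b * kp - a₂) * v 0 + (b * kd - a₁) * v 1] := by
  ext i
  fin_cases i <;> simp [pdGenerator, Matrix.toLin'_apply, Matrix.mulVec, dotProduct,
    Fin.sum_univ_two]

lemma pidGenerator_apply (v : Fin 3 → ℝ) : pidGenerator a₁ a₂ b kp ki kd v =
    ![v 1, (b * kp - a₂) * v 0 + (b * kd - a₁) * v 1 + b * ki * v 2, v 0] := by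
  ext i
  fin_cases i <;> simp [pidGenerator, Matrix.toLin'_apply, Matrix.mulVec, dotProduct,
    Fin.sum_univ_three]

lemma isPIDSolution_of_hasDerivAt_pdGenerator (hb : b * ki = 0) {X : ℝ → Fin 2 → ℝ}
    (hX : ∀ t, HasDerivAt X (pdGenerator a₁ a₂ b kp kd (X t)) t) :
    IsPIDSolution a₁ a₂ b kp ki kd (fun t => X t 0) fun t => X t 1 := by
  simp only [pdGenerator_apply] at hX
  refine ⟨fun t _ => (hasDerivAt_pi.1 (hX t) 0).hasDerivWithinAt, fun t _ =>
    (hasDerivAt_pi.1 (hX t) 1).hasDerivWithinAt.congr_deriv ?_⟩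
  simp only [Matrix.cons_val_one, Matrix.cons_val_fin_one, pidControl]
  linear_combination (-∫ s in (0 : ℝ)..t, X s 0) * hb

lemma integral_eq_of_hasDerivAt_pidGenerator {X : ℝ → Fin 3 → ℝ}
    (hX : ∀ t, HasDerivAt X (pidGenerator a₁ a₂ b kp ki kd (X t)) t) (h0 : X 0 2 = 0) (t : ℝ) :
    ∫ s in (0 : ℝ)..t, X s 0 = X t 2 := by
  have hcont : Continuous X := continuous_iff_continuousAt.2 fun t => (hX t).continuousAt
  simp only [pidGenerator_apply] at hX
  rw [intervalIntegral.integral_eq_sub_of_hasDerivAt (f := fun s => X s 2) (f' := fun s => X s 0)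
    (fun s _ => hasDerivAt_pi.1 (hX s) 2) ((continuous_pi_iff.1 hcont 0).intervalIntegrable 0 t),
    h0, sub_zero]

lemma isPIDSolution_of_hasDerivAt_pidGenerator {X : ℝ → Fin 3 → ℝ}
    (hX : ∀ t, HasDerivAt X (pidGenerator a₁ a₂ b kp ki kd (X t)) t) (h0 : X 0 2 = 0) :
    IsPIDSolution a₁ a₂ b kp ki kd (fun t => X t 0) fun t => X t 1 := by
  have hint := integral_eq_of_hasDerivAt_pidGenerator hX h0
  simp only [pidGenerator_apply] at hX
  refine ⟨fun t _ => (hasDerivAt_pi.1 (hX t) 0).hasDerivWithinAt, fun t _ =>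
    (hasDerivAt_pi.1 (hX t) 1).hasDerivWithinAt.congr_deriv ?_⟩
  simp only [Matrix.cons_val_one, Matrix.cons_val_zero, pidControl, hint]
  ring

lemma PIDStabilizes.exists_semigroupDecays (hb : b * ki = 0)
    (H : PIDStabilizes a₁ a₂ b kp ki kd β) :
    ∃ M, 0 ≤ M ∧ SemigroupDecays (pdGenerator a₁ a₂ b kp kd) M β := by
  obtain ⟨M, hM⟩ := pidStabilizes_iff.1 H
  refine ⟨|M|, abs_nonneg M, fun t ht v => ?_⟩
  have hdecay := hM _ _ (isPIDSolution_of_hasDerivAt_pdGenerator hb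
    (hasDerivAt_exp_smul_apply (pdGenerator a₁ a₂ b kp kd) v)) t ht
  have heta : ∀ w : Fin 2 → ℝ, ![w 0, w 1] = w := FinVec.etaExpand_eq
  simp only [heta, zero_smul, NormedSpace.exp_zero, one_apply_eq_self] at hdecay
  exact hdecay.trans (by gcongr; exact le_abs_self M)

lemma PIDStabilizesFull.exists_norm_exp_smul_apply_le
    (H : PIDStabilizesFull a₁ a₂ b kp ki kd β) :
    ∃ M, 0 ≤ M ∧ ∀ v : Fin 3 → ℝ, v 2 = 0 → ∀ t : ℝ, 0 ≤ t →
      ‖NormedSpace.exp (t • pidGenerator a₁ a₂ b kp ki kd) v‖ ≤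
        M * Real.exp (-β * t) * ‖v‖ := by
  obtain ⟨M, hM⟩ := pidStabilizesFull_iff.1 H
  refine ⟨|M|, abs_nonneg M, fun v hv t ht => ?_⟩
  set X : ℝ → Fin 3 → ℝ := fun t => NormedSpace.exp (t • pidGenerator a₁ a₂ b kp ki kd) v with hX
  have hX0 : X 0 = v := by simp [hX]
  have hXd : ∀ t, HasDerivAt X (pidGenerator a₁ a₂ b kp ki kd (X t)) t :=
    hasDerivAt_exp_smul_apply _ v
  have h0 : X 0 2 = 0 := by rw [hX0, hv]
  have hdecay := hM _ _ (isPIDSolution_of_hasDerivAt_pidGenerator hXd h0) t ht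
  have heta : ∀ w : Fin 3 → ℝ, ![w 0, w 1, w 2] = w := FinVec.etaExpand_eq
  simp only [integral_eq_of_hasDerivAt_pidGenerator hXd h0, heta, hX0] at hdecay
  exact hdecay.trans (by gcongr; exact le_abs_self M)

/- Initial integral states other than zero are not seen by the hypothesis. But `e^{tA}` commutes
with `A`, so the decay on the plane `x₃ = 0` passes to the image of that plane under `A`, which
contains the missing direction. -/
lemma PIDStabilizesFull.exists_semigroupDecays
    (H : PIDStabilizesFull a₁ a₂ b kp ki kd β) :
    ∃ M, 0 ≤ M ∧ SemigroupDecays (pidGenerator a₁ a₂ b kp ki kd) M β := by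
  obtain ⟨M, hM0, plane⟩ := H.exists_norm_exp_smul_apply_le
  set A := pidGenerator a₁ a₂ b kp ki kd with hA
  set c := b * kp - a₂ with hc
  refine ⟨M * (1 + |c| + ‖A‖), by positivity, fun t ht v => ?_⟩
  have hv : ∀ i, |v i| ≤ ‖v‖ := norm_le_pi_norm v
  have hsplit : v = ![v 0, v 1 - c * v 2, 0] + A ![v 2, 0, 0] := by
    rw [hA, pidGenerator_apply]
    ext i
    fin_cases i <;> simp [hc]
  have hp : ‖![v 0, v 1 - c * v 2, 0]‖ ≤ (1 + |c|) * ‖v‖ := by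
    have : 0 ≤ |c| * ‖v‖ := by positivity
    refine norm_vec3_le_iff.2 ⟨by linarith [hv 0], ?_, by rw [abs_zero]; positivity⟩
    grw [abs_sub, abs_mul, hv 1, hv 2]
    linarith
  have hr : ‖![v 2, 0, 0]‖ ≤ ‖v‖ := norm_vec3_le_iff.2 ⟨hv 2, by simp, by simp⟩
  calc ‖NormedSpace.exp (t • A) v‖
    _ = ‖NormedSpace.exp (t • A) ![v 0, v 1 - c * v 2, 0] +
          A (NormedSpace.exp (t • A) ![v 2, 0, 0])‖ := by
        rw [← exp_smul_apply_comm, ← map_add, ← hsplit]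
    _ ≤ M * Real.exp (-β * t) * ‖![v 0, v 1 - c * v 2, 0]‖ +
          ‖A‖ * (M * Real.exp (-β * t) * ‖![v 2, 0, 0]‖) := by
        grw [norm_add_le, A.le_opNorm, plane _ rfl t ht, plane _ rfl t ht]
    _ ≤ M * Real.exp (-β * t) * ((1 + |c|) * ‖v‖) +
          ‖A‖ * (M * Real.exp (-β * t) * ‖v‖) := by gcongr
    _ = M * (1 + |c| + ‖A‖) * Real.exp (-β * t) * ‖v‖ := by ring

end Continuous

/-! ### The event-triggered loop as a perturbation of the continuous one -/

section Perturbation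

variable {a₁ a₂ b h kp ki kd σ α Z T t : ℝ} {q : ℕ} {y dy : ℝ → ℝ}

lemma mul_exp_neg_mul_le {c s : ℝ} (hα : 0 ≤ α) (hZ : 0 ≤ Z) (hst : t - c ≤ s) :
    Z * Real.exp (-α * s) ≤ Real.exp (c * α) * (Z * Real.exp (-α * t)) := by
  calc Z * Real.exp (-α * s) ≤ Z * Real.exp (c * α + -α * t) := by
        gcongr
        linarith [mul_le_mul_of_nonneg_left hst hα]
    _ = Real.exp (c * α) * (Z * Real.exp (-α * t)) := by rw [Real.exp_add]; ring

lemma IsEventSolution.abs_y_sub_le (hs : IsEventSolution a₁ a₂ b h q kp ki kd σ y dy) {r s C : ℝ}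
    (hr : 0 ≤ r) (hrs : r ≤ s) (hC : ∀ x ∈ Ico r s, |dy x| ≤ C) : |y s - y r| ≤ C * (s - r) :=
  norm_image_sub_le_of_norm_deriv_right_le_segment
    (hs.continuousOn_y.mono fun _ hx => hr.trans hx.1)
    (fun _ hx => hs.hasDeriv_y_right (hr.trans hx.1)) hC s (right_mem_Icc.2 hrs)

lemma IsEventSolution.abs_dy_sub_le (hh : 0 < h)
    (hs : IsEventSolution a₁ a₂ b h q kp ki kd σ y dy) {r s C : ℝ} (hr : 0 ≤ r) (hrs : r ≤ s)
    (hC : ∀ x ∈ Ico r s, |eventAccel a₁ a₂ b h q kp ki kd σ y dy x| ≤ C) :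
    |dy s - dy r| ≤ C * (s - r) :=
  norm_image_sub_le_of_norm_deriv_right_le_segment
    (hs.continuousOn_dy.mono fun _ hx => hr.trans hx.1)
    (fun _ hx => hs.hasDeriv_dy_right hh (hr.trans hx.1)) hC s (right_mem_Icc.2 hrs)

lemma IsEventSolution.abs_slope_sub_le (hh : 0 < h)
    (hs : IsEventSolution a₁ a₂ b h q kp ki kd σ y dy) {r s C : ℝ} (hr : 0 ≤ r) (hrs : r < s)
    (hst : s ≤ t) (hC : ∀ x ∈ Ico r t, |eventAccel a₁ a₂ b h q kp ki kd σ y dy x| ≤ C) :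
    |(y s - y r) / (s - r) - dy t| ≤ C * (t - r) := by
  obtain ⟨c, hc, hslope⟩ := exists_hasDerivAt_eq_slope y dy hrs
    (hs.continuousOn_y.mono fun x hx => hr.trans hx.1) fun x hx =>
      (hs.hasDeriv_y x (hr.trans hx.1.le)).hasDerivAt (Ici_mem_nhds (hr.trans_lt hx.1))
  have hct : c ≤ t := hc.2.le.trans hst
  have hC0 : 0 ≤ C := (abs_nonneg _).trans (hC r ⟨le_rfl, hrs.trans_le hst⟩)
  rw [← hslope, abs_sub_comm]
  calc |dy t - dy c| ≤ C * (t - c) :=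
        hs.abs_dy_sub_le hh (hr.trans hc.1.le) hct fun x hx => hC x ⟨hc.1.le.trans hx.1, hx.2⟩
    _ ≤ C * (t - r) := by gcongr; exact hc.1.le

lemma sampledIntegral_sub_sampledIntegral_floor (hh : 0 < h) (y : ℝ → ℝ) (t : ℝ) :
    sampledIntegral h y t - sampledIntegral h y (⌊t / h⌋₊ * h) =
      (t - ⌊t / h⌋₊ * h) * y (⌊t / h⌋₊ * h) := by
  simp [sampledIntegral, mul_div_cancel_right₀ _ hh.ne']

/-- The sampled-data control that replaces the derivative in the PID control law by the difference
quotient over the delay `q h`. -/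
noncomputable abbrev differenceControl (h : ℝ) (q : ℕ) (kp ki kd : ℝ) (y : ℝ → ℝ) : ℕ → ℝ :=
  sampledControl h q (kp + kd / (q * h)) ki (-(kd / (q * h))) y

/-- Solutions of the event-triggered closed loop under `differenceControl`. -/
abbrev IsDifferenceSolution (a₁ a₂ b h : ℝ) (q : ℕ) (kp ki kd σ : ℝ) (y dy : ℝ → ℝ) : Prop :=
  IsEventSolution a₁ a₂ b h q (kp + kd / (q * h)) ki (-(kd / (q * h))) σ y dy

/-- Decay of a trajectory on `[0, T]`. The weight `κ` is the coefficient with which the integral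
acts on the plant: for `κ = 0` nothing is asked of the integral state. -/
structure StateDecays (κ α Z T h : ℝ) (y dy : ℝ → ℝ) : Prop where
  abs_y_le : ∀ s ∈ Icc 0 T, |y s| ≤ Z * Real.exp (-α * s)
  abs_dy_le : ∀ s ∈ Icc 0 T, |dy s| ≤ Z * Real.exp (-α * s)
  abs_integral_le : ∀ s ∈ Icc 0 T,
    |κ| * |sampledIntegral h y s| ≤ |κ| * (Z * Real.exp (-α * s))

/-- The gain from the decaying bound on the state to `b u(t_k)` under `differenceControl`. -/
noncomputable def controlGain (b kp ki kd α : ℝ) : ℝ :=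
  |b| * (|kp| + |kd| * Real.exp α) + |b * ki|

/-- The gain from the decaying bound on the state to `y''` under `differenceControl`. -/
noncomputable def accelGain (a₁ a₂ b kp ki kd α : ℝ) : ℝ :=
  2 * controlGain b kp ki kd α * Real.exp α + |a₁| + |a₂|

/-- The gain from the decaying bound on the state to the difference between the vector fields of
the event-triggered and the continuous closed loop. -/
noncomputable def perturbationGain (a₁ a₂ b h : ℝ) (q : ℕ) (kp ki kd σ α : ℝ) : ℝ :=
  Real.exp (2 * α) * (√σ * controlGain b kp ki kd α + (|b * kp| + |b * ki| + 1) * h +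
    |b * kd| * (q * h + h) * accelGain a₁ a₂ b kp ki kd α)

lemma controlGain_nonneg : 0 ≤ controlGain b kp ki kd α := by
  unfold controlGain
  positivity

lemma accelGain_nonneg : 0 ≤ accelGain a₁ a₂ b kp ki kd α := by
  have : 0 ≤ controlGain b kp ki kd α := controlGain_nonneg
  unfold accelGain
  positivity

lemma perturbationGain_nonneg (hh : 0 ≤ h) :
    0 ≤ perturbationGain a₁ a₂ b h q kp ki kd σ α := by
  have : 0 ≤ controlGain b kp ki kd α := controlGain_nonneg
  have : 0 ≤ accelGain a₁ a₂ b kp ki kd α := accelGain_nonneg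
  unfold perturbationGain
  positivity

lemma differenceControl_eq (hh : 0 < h) (y : ℝ → ℝ) {k : ℕ} (hk : q ≤ k) :
    differenceControl h q kp ki kd y k =
      kp * y (k * h) + ki * sampledIntegral h y (k * h) +
        kd * ((y (k * h) - y (k * h - q * h)) / (q * h)) := by
  rw [differenceControl, sampledControl_eq hh, delayedSample_eq y hk]
  ring

lemma StateDecays.abs_sample_sub_le {κ : ℝ} (hX : StateDecays κ α Z T h y dy) (hh : 0 < h)
    (hh1 : h ≤ 1) (hα : 0 ≤ α) (hZ : 0 ≤ Z) (hs : IsEventSolution a₁ a₂ b h q kp ki kd σ y dy)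
    (ht : t ∈ Icc 0 T) :
    |y (⌊t / h⌋₊ * h) - y t| ≤ Real.exp (2 * α) * (Z * Real.exp (-α * t)) * h := by
  have hgrid := mem_Ico_floor_mul hh ht.1
  have hk0 : 0 ≤ ⌊t / h⌋₊ * h := by positivity
  rw [abs_sub_comm]
  refine (hs.abs_y_sub_le hk0 hgrid.1 fun x hx =>
    (hX.abs_dy_le x ⟨hk0.trans hx.1, hx.2.le.trans ht.2⟩).trans
      (mul_exp_neg_mul_le (c := 2) (t := t) hα hZ (by linarith [hx.1, hgrid.2]))).trans ?_
  gcongr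
  linarith [hgrid.2]

lemma StateDecays.abs_sampledIntegral_sub_le {κ : ℝ} (hX : StateDecays κ α Z T h y dy)
    (hh : 0 < h) (hh1 : h ≤ 1) (hα : 0 ≤ α) (hZ : 0 ≤ Z) (ht : t ∈ Icc 0 T) :
    |sampledIntegral h y (⌊t / h⌋₊ * h) - sampledIntegral h y t| ≤
      Real.exp (2 * α) * (Z * Real.exp (-α * t)) * h := by
  have hgrid := mem_Ico_floor_mul hh ht.1
  have hsample : |y (⌊t / h⌋₊ * h)| ≤ Real.exp (2 * α) * (Z * Real.exp (-α * t)) :=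
    (hX.abs_y_le _ ⟨by positivity, hgrid.1.trans ht.2⟩).trans
      (mul_exp_neg_mul_le hα hZ (by linarith [hgrid.2]))
  have hstep : 0 ≤ t - ⌊t / h⌋₊ * h := sub_nonneg.2 hgrid.1
  rw [abs_sub_comm, sampledIntegral_sub_sampledIntegral_floor hh, abs_mul, abs_of_nonneg hstep,
    mul_comm]
  gcongr
  linarith [hgrid.2]

lemma stateDeriv_sub_pidGenerator (y dy : ℝ → ℝ) (t : ℝ) :
    stateDeriv a₁ a₂ b h q (kp + kd / (q * h)) ki (-(kd / (q * h))) σ y dy t -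
        pidGenerator a₁ a₂ b kp ki kd (stateVec h y dy t) =
      ![0, b * (eventControl σ (differenceControl h q kp ki kd y) ⌊t / h⌋₊ -
        (kp * y t + ki * sampledIntegral h y t + kd * dy t)), y (⌊t / h⌋₊ * h) - y t] := by
  rw [pidGenerator_apply]
  ext i
  fin_cases i
  · simp [stateDeriv, stateVec]
  · simp only [stateDeriv, stateVec, eventAccel, Fin.mk_one, Pi.sub_apply, Matrix.cons_val]
    ring
  · simp [stateDeriv, stateVec]

section Bounds

variable (hh : 0 < h) (hq : 0 < q) (hqh : q * h ≤ 1) (hα : 0 ≤ α) (hZ : 0 ≤ Z)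
  (hs : IsDifferenceSolution a₁ a₂ b h q kp ki kd σ y dy)
  (hX : StateDecays (b * ki) α Z T h y dy)
include hh hq hqh hα hZ hs hX

lemma abs_mul_differenceControl_le {k : ℕ} (hk : q ≤ k) (hkT : k * h ≤ T) :
    |b * differenceControl h q kp ki kd y k| ≤
      controlGain b kp ki kd α * (Z * Real.exp (-α * (k * h))) := by
  have hqh0 : 0 < q * h := by positivity
  have hqk : (q : ℝ) * h ≤ k * h := by gcongr
  have hkI : (k : ℝ) * h ∈ Icc 0 T := ⟨hqh0.le.trans hqk, hkT⟩
  set v := Z * Real.exp (-α * (k * h))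
  have hslope : |(y (k * h) - y (k * h - q * h)) / (q * h)| ≤ Real.exp α * v := by
    rw [abs_div, abs_of_pos hqh0, div_le_iff₀ hqh0]
    refine (hs.abs_y_sub_le (sub_nonneg.2 hqk) (sub_le_self _ hqh0.le) fun x hx => ?_).trans_eq
      (by rw [sub_sub_cancel])
    simpa only [one_mul] using (hX.abs_dy_le x ⟨(sub_nonneg.2 hqk).trans hx.1,
      hx.2.le.trans hkT⟩).trans (mul_exp_neg_mul_le (c := 1) hα hZ (by linarith [hx.1]))
  calc |b * differenceControl h q kp ki kd y k|
    _ = |b * kp * y (k * h) + b * ki * sampledIntegral h y (k * h) +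
          b * kd * ((y (k * h) - y (k * h - q * h)) / (q * h))| := by
        rw [differenceControl_eq hh y hk]; ring_nf
    _ ≤ |b * kp| * |y (k * h)| + |b * ki| * |sampledIntegral h y (k * h)| +
          |b * kd| * |(y (k * h) - y (k * h - q * h)) / (q * h)| := by
        rw [← abs_mul, ← abs_mul, ← abs_mul]
        exact abs_add_three _ _ _
    _ ≤ |b * kp| * v + |b * ki| * v + |b * kd| * (Real.exp α * v) :=
        add_le_add_three (by gcongr; exact hX.abs_y_le _ hkI) (hX.abs_integral_le _ hkI)
          (by gcongr)
    _ = controlGain b kp ki kd α * v := by rw [controlGain, abs_mul b kp, abs_mul b kd]; ring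

variable (hσ : 0 ≤ σ) (hσ1 : σ ≤ 1)
include hσ hσ1

lemma abs_eventAccel_le_accelGain_mul (ht : q * h ≤ t) (htT : t ≤ T) :
    |eventAccel a₁ a₂ b h q (kp + kd / (q * h)) ki (-(kd / (q * h))) σ y dy t| ≤
      accelGain a₁ a₂ b kp ki kd α * (Z * Real.exp (-α * t)) := by
  have hh1 : h ≤ 1 := (le_mul_of_one_le_left hh.le (mod_cast hq)).trans hqh
  have htI : t ∈ Icc 0 T := ⟨le_trans (by positivity) ht, htT⟩
  have hk : q ≤ ⌊t / h⌋₊ := Nat.le_floor ((le_div_iff₀ hh).2 ht)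
  have hgrid := mem_Ico_floor_mul hh htI.1
  set v := Z * Real.exp (-α * t)
  have hcontrol : |b| * |differenceControl h q kp ki kd y ⌊t / h⌋₊| ≤
      controlGain b kp ki kd α * (Real.exp α * v) := by
    rw [← abs_mul]
    refine (abs_mul_differenceControl_le hh hq hqh hα hZ hs hX hk (hgrid.1.trans htT)).trans ?_
    refine mul_le_mul_of_nonneg_left ?_ controlGain_nonneg
    simpa only [one_mul] using mul_exp_neg_mul_le (c := 1) hα hZ (by linarith [hgrid.2])
  calc _ ≤ 2 * (|b| * |differenceControl h q kp ki kd y ⌊t / h⌋₊|) +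
          |a₁| * |dy t| + |a₂| * |y t| :=
        (abs_eventAccel_le hσ hσ1 t).trans_eq (by rw [mul_assoc 2])
    _ ≤ 2 * (controlGain b kp ki kd α * (Real.exp α * v)) + |a₁| * v + |a₂| * v := by
        gcongr
        exacts [hX.abs_dy_le t htI, hX.abs_y_le t htI]
    _ = accelGain a₁ a₂ b kp ki kd α * v := by rw [accelGain]; ring

lemma abs_slope_sub_dy_le (ht : 2 * (q * h) ≤ t) (htT : t ≤ T) :
    |(y (⌊t / h⌋₊ * h) - y (⌊t / h⌋₊ * h - q * h)) / (q * h) - dy t| ≤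
      accelGain a₁ a₂ b kp ki kd α * (Real.exp (2 * α) * (Z * Real.exp (-α * t))) *
        (q * h + h) := by
  have hh1 : h ≤ 1 := (le_mul_of_one_le_left hh.le (mod_cast hq)).trans hqh
  have hqh0 : 0 < q * h := by positivity
  have hk : (2 * q : ℕ) ≤ ⌊t / h⌋₊ := Nat.le_floor ((le_div_iff₀ hh).2 (by push_cast; linarith))
  have hgrid := mem_Ico_floor_mul hh (t := t) (by linarith)
  have hkq : (q : ℝ) * h ≤ ⌊t / h⌋₊ * h - q * h := by
    have : ((2 * q : ℕ) : ℝ) * h ≤ ⌊t / h⌋₊ * h := by gcongr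
    push_cast at this
    linarith
  have hL : 0 ≤ accelGain a₁ a₂ b kp ki kd α := accelGain_nonneg
  have hslope := hs.abs_slope_sub_le hh (hqh0.le.trans hkq) (sub_lt_self _ hqh0) hgrid.1
    fun x hx => (abs_eventAccel_le_accelGain_mul hh hq hqh hα hZ hs hX hσ hσ1
      (hkq.trans hx.1) (hx.2.le.trans htT)).trans (mul_le_mul_of_nonneg_left
        (mul_exp_neg_mul_le (c := 2) (t := t) hα hZ (by linarith [hx.1, hgrid.2])) hL)
  rw [sub_sub_cancel] at hslope
  refine hslope.trans ?_
  gcongr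
  linarith [hgrid.2]

lemma abs_mul_eventControl_sub_le (ht : 2 * (q * h) ≤ t) (htT : t ≤ T) :
    |b * (eventControl σ (differenceControl h q kp ki kd y) ⌊t / h⌋₊ -
        (kp * y t + ki * sampledIntegral h y t + kd * dy t))| ≤
      (√σ * controlGain b kp ki kd α + (|b * kp| + |b * ki|) * h +
        |b * kd| * (q * h + h) * accelGain a₁ a₂ b kp ki kd α) *
          (Real.exp (2 * α) * (Z * Real.exp (-α * t))) := by
  have hh1 : h ≤ 1 := (le_mul_of_one_le_left hh.le (mod_cast hq)).trans hqh
  have hqh0 : 0 < q * h := by positivity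
  have ht0 : 0 ≤ t := by linarith
  have hgrid := mem_Ico_floor_mul hh ht0
  have hk : q ≤ ⌊t / h⌋₊ := Nat.le_floor ((le_div_iff₀ hh).2 (by linarith))
  have hU : 0 ≤ controlGain b kp ki kd α := controlGain_nonneg
  have hsample := hX.abs_sample_sub_le hh hh1 hα hZ hs ⟨ht0, htT⟩
  have hintegral := hX.abs_sampledIntegral_sub_le hh hh1 hα hZ ⟨ht0, htT⟩
  have hslope := abs_slope_sub_dy_le hh hq hqh hα hZ hs hX hσ hσ1 ht htT
  have hcontrol := (abs_mul_differenceControl_le hh hq hqh hα hZ hs hX hk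
    (hgrid.1.trans htT)).trans (mul_le_mul_of_nonneg_left
      (mul_exp_neg_mul_le (c := 2) (t := t) hα hZ (by linarith [hgrid.2])) hU)
  have htrigger := abs_eventControl_sub_le hσ (differenceControl h q kp ki kd y) ⌊t / h⌋₊
  set V := Real.exp (2 * α) * (Z * Real.exp (-α * t))
  set u := differenceControl h q kp ki kd y ⌊t / h⌋₊ with hu
  set v := eventControl σ (differenceControl h q kp ki kd y) ⌊t / h⌋₊
  rw [differenceControl_eq hh y hk] at hu
  calc _ = |b * (v - u) + b * kp * (y (⌊t / h⌋₊ * h) - y t) +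
          b * ki * (sampledIntegral h y (⌊t / h⌋₊ * h) - sampledIntegral h y t) +
          b * kd * ((y (⌊t / h⌋₊ * h) - y (⌊t / h⌋₊ * h - q * h)) / (q * h) - dy t)| := by
        rw [hu]; ring_nf
    _ ≤ |b| * (√σ * |u|) + |b * kp| * (V * h) + |b * ki| * (V * h) +
          |b * kd| * (accelGain a₁ a₂ b kp ki kd α * V * (q * h + h)) := by
        grw [abs_add_le, abs_add_three, abs_mul b, abs_mul (b * kp), abs_mul (b * ki),
          abs_mul (b * kd), hsample, hintegral, hslope, htrigger]
    _ = √σ * |b * u| + |b * kp| * (V * h) + |b * ki| * (V * h) +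
          |b * kd| * (accelGain a₁ a₂ b kp ki kd α * V * (q * h + h)) := by
        rw [abs_mul b u]; ring
    _ ≤ √σ * (controlGain b kp ki kd α * V) + |b * kp| * (V * h) + |b * ki| * (V * h) +
          |b * kd| * (accelGain a₁ a₂ b kp ki kd α * V * (q * h + h)) := by gcongr
    _ = _ := by ring

lemma norm_stateDeriv_sub_pidGenerator_le (ht : 2 * (q * h) ≤ t) (htT : t ≤ T) :
    ‖stateDeriv a₁ a₂ b h q (kp + kd / (q * h)) ki (-(kd / (q * h))) σ y dy t -
        pidGenerator a₁ a₂ b kp ki kd (stateVec h y dy t)‖ ≤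
      perturbationGain a₁ a₂ b h q kp ki kd σ α * Z * Real.exp (-α * t) := by
  have hh1 : h ≤ 1 := (le_mul_of_one_le_left hh.le (mod_cast hq)).trans hqh
  have ht0 : 0 ≤ t := le_trans (by positivity) ht
  have hsample := hX.abs_sample_sub_le hh hh1 hα hZ hs ⟨ht0, htT⟩
  have hcontrol := abs_mul_eventControl_sub_le hh hq hqh hα hZ hs hX hσ hσ1 ht htT
  have hL : 0 ≤ accelGain a₁ a₂ b kp ki kd α := accelGain_nonneg
  have hU : 0 ≤ controlGain b kp ki kd α := controlGain_nonneg
  set V := Real.exp (2 * α) * (Z * Real.exp (-α * t)) with hV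
  set η := √σ * controlGain b kp ki kd α + (|b * kp| + |b * ki|) * h +
    |b * kd| * (q * h + h) * accelGain a₁ a₂ b kp ki kd α with hη
  have hηV : 0 ≤ η * V := by positivity
  have hVh : 0 ≤ V * h := by positivity
  have hsum : perturbationGain a₁ a₂ b h q kp ki kd σ α * Z * Real.exp (-α * t) =
      η * V + V * h := by rw [perturbationGain, hV, hη]; ring
  rw [hsum, stateDeriv_sub_pidGenerator]
  exact norm_vec3_le_iff.2 ⟨by rw [abs_zero]; positivity, by linarith, by linarith⟩

end Bounds

end Perturbation

/-! ### Sampled-data implementation of a continuous PID controller -/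

section Implementation

variable {a₁ a₂ b h kp ki kd σ α β M : ℝ}

lemma delayOf_pos (hh : 0 < h) (hh1 : h ≤ 1) : 0 < delayOf h :=
  Nat.floor_pos.2 (Real.one_le_rpow_of_pos_of_le_one_of_nonpos hh hh1 (by norm_num))

lemma delayOf_mul_le_sqrt (hh : 0 < h) : delayOf h * h ≤ √h :=
  calc delayOf h * h ≤ h ^ (-(1 / 2) : ℝ) * h := by
        gcongr
        exact Nat.floor_le (by positivity)
    _ = √h := by
        rw [← Real.rpow_add_one hh.ne', Real.sqrt_eq_rpow]
        norm_num

lemma exists_perturbationGain_le (a₁ a₂ b kp ki kd α : ℝ) {ε : ℝ} (hε : 0 < ε) :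
    ∃ r > 0, r ≤ 1 ∧ ∀ h σ : ℝ, 0 < h → h < r → 0 ≤ σ → σ < r →
      perturbationGain a₁ a₂ b h (delayOf h) kp ki kd σ α ≤ ε := by
  have hL : 0 ≤ accelGain a₁ a₂ b kp ki kd α := accelGain_nonneg
  set bound : ℝ × ℝ → ℝ := fun p => Real.exp (2 * α) * (√p.2 * controlGain b kp ki kd α +
    (|b * kp| + |b * ki| + 1) * p.1 + |b * kd| * (√p.1 + p.1) * accelGain a₁ a₂ b kp ki kd α)
    with hbound
  have hcont : Continuous bound := by fun_prop
  obtain ⟨δ, hδ, hsmall⟩ := Metric.continuous_iff.1 hcont 0 ε hε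
  refine ⟨min δ 1, by positivity, min_le_right δ 1, fun h σ hh hhr hσ hσr => ?_⟩
  have hdist : dist ((h, σ) : ℝ × ℝ) 0 < δ := by
    rw [dist_zero_right, Prod.norm_def, Real.norm_of_nonneg hh.le, Real.norm_of_nonneg hσ]
    exact max_lt (hhr.trans_le (min_le_left δ 1)) (hσr.trans_le (min_le_left δ 1))
  calc perturbationGain a₁ a₂ b h (delayOf h) kp ki kd σ α ≤ bound (h, σ) := by
        unfold perturbationGain
        simp only [hbound]
        gcongr
        exact delayOf_mul_le_sqrt hh
    _ ≤ ε := by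
        have := (le_abs_self _).trans (hsmall (h, σ) hdist).le
        simpa [hbound] using this

variable {E : Type*} [NormedAddCommGroup E] [NormedSpace ℝ E]
  {Λ : (Fin 3 → ℝ) →L[ℝ] E} {A : E →L[ℝ] E}

/-- `Λ` reduces the continuous closed loop to `x' = A x` without losing the state variables that
act on the plant: `y`, `y'` and, if `b ki ≠ 0`, the integral. -/
structure IsReduction (a₁ a₂ b kp ki kd : ℝ) (Λ : (Fin 3 → ℝ) →L[ℝ] E) (A : E →L[ℝ] E) :
    Prop where
  map_pidGenerator : ∀ v, Λ (pidGenerator a₁ a₂ b kp ki kd v) = A (Λ v)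
  abs_y_le : ∀ v, |v 0| ≤ ‖Λ v‖
  abs_dy_le : ∀ v, |v 1| ≤ ‖Λ v‖
  abs_integral_le : ∀ v, |b * ki| * |v 2| ≤ |b * ki| * ‖Λ v‖

lemma isReduction_id : IsReduction a₁ a₂ b kp ki kd (.id ℝ _) (pidGenerator a₁ a₂ b kp ki kd) where
  map_pidGenerator _ := rfl
  abs_y_le v := norm_le_pi_norm v 0
  abs_dy_le v := norm_le_pi_norm v 1
  abs_integral_le v := mul_le_mul_of_nonneg_left (norm_le_pi_norm v 2) (abs_nonneg _)

/-- The projection of the state `(y, y', ∫ y)` to the plant state `(y, y')`. -/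
noncomputable def plantState : (Fin 3 → ℝ) →L[ℝ] (Fin 2 → ℝ) :=
  .pi fun i => .proj i.castSucc

lemma plantState_apply (v : Fin 3 → ℝ) : plantState v = ![v 0, v 1] := by
  ext i
  fin_cases i <;> rfl

lemma isReduction_plantState (hb : b * ki = 0) :
    IsReduction a₁ a₂ b kp ki kd plantState (pdGenerator a₁ a₂ b kp kd) where
  map_pidGenerator v := by
    simp [pidGenerator_apply, pdGenerator_apply, plantState_apply, hb]
  abs_y_le v := norm_le_pi_norm (plantState v) 0
  abs_dy_le v := norm_le_pi_norm (plantState v) 1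
  abs_integral_le v := by simp [hb]

lemma IsReduction.stateDecays {Z T : ℝ} {y dy : ℝ → ℝ}
    (hR : IsReduction a₁ a₂ b kp ki kd Λ A)
    (hX : ∀ s ∈ Icc 0 T, ‖Λ (stateVec h y dy s)‖ ≤ Z * Real.exp (-α * s)) :
    StateDecays (b * ki) α Z T h y dy where
  abs_y_le s hs := (hR.abs_y_le _).trans (hX s hs)
  abs_dy_le s hs := (hR.abs_dy_le _).trans (hX s hs)
  abs_integral_le s hs :=
    (hR.abs_integral_le _).trans (mul_le_mul_of_nonneg_left (hX s hs) (abs_nonneg _))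

lemma IsReduction.norm_map_stateDeriv_sub_le {q : ℕ} {y dy : ℝ → ℝ} {Z T t : ℝ}
    (hR : IsReduction a₁ a₂ b kp ki kd Λ A) (hh : 0 < h) (hq : 0 < q) (hqh : q * h ≤ 1)
    (hα : 0 ≤ α) (hσ : 0 ≤ σ) (hσ1 : σ ≤ 1) (hZ : 0 ≤ Z)
    (hs : IsDifferenceSolution a₁ a₂ b h q kp ki kd σ y dy)
    (hX : ∀ s ∈ Icc 0 T, ‖Λ (stateVec h y dy s)‖ ≤ Z * Real.exp (-α * s))
    (ht : t ∈ Icc (2 * (q * h)) T) :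
    ‖Λ (stateDeriv a₁ a₂ b h q (kp + kd / (q * h)) ki (-(kd / (q * h))) σ y dy t) -
        A (Λ (stateVec h y dy t))‖ ≤
      ‖Λ‖ * perturbationGain a₁ a₂ b h q kp ki kd σ α * Z * Real.exp (-α * t) := by
  rw [← hR.map_pidGenerator, ← map_sub, mul_assoc, mul_assoc, ← mul_assoc (perturbationGain ..)]
  refine Λ.le_opNorm_of_le (norm_stateDeriv_sub_pidGenerator_le hh hq hqh hα hZ hs
    (hR.stateDecays hX) hσ hσ1 ht.1 ht.2)

variable [CompleteSpace E]

lemma IsReduction.exists_norm_map_stateVec_le {q : ℕ} (hR : IsReduction a₁ a₂ b kp ki kd Λ A)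
    (hM : 0 ≤ M) (hA : SemigroupDecays A M β) (hα : 0 ≤ α) (hαβ : α < β) (hh : 0 < h)
    (hq : 0 < q) (hqh : q * h ≤ 1) (hσ : 0 ≤ σ) (hσ1 : σ ≤ 1)
    (hsmall : M * (‖Λ‖ * perturbationGain a₁ a₂ b h q kp ki kd σ α) / (β - α) ≤ 1 / 2) :
    ∃ C, 0 ≤ C ∧ ∀ y dy : ℝ → ℝ, IsDifferenceSolution a₁ a₂ b h q kp ki kd σ y dy →
      ∀ t, 0 ≤ t →
        ‖Λ (stateVec h y dy t)‖ ≤ C * Real.exp (-α * t) * ‖stateVec h y dy 0‖ := by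
  obtain ⟨C, hC, hinit⟩ := exists_norm_stateVec_le a₁ a₂ b hh q (kp + kd / (q * h)) ki
    (-(kd / (q * h))) hσ hσ1 (2 * q)
  have hgain : 0 ≤ perturbationGain a₁ a₂ b h q kp ki kd σ α := perturbationGain_nonneg hh.le
  have ht₀ : 0 ≤ 2 * (q * h) := by positivity
  refine ⟨(2 * M + 1) * Real.exp (α * (2 * (q * h))) * (‖Λ‖ * C), by positivity,
    fun y dy hs t ht => ?_⟩
  have hdecay := norm_le_of_small_gain (X := fun s => Λ (stateVec h y dy s))
    (d := fun s => Λ (stateDeriv a₁ a₂ b h q (kp + kd / (q * h)) ki (-(kd / (q * h))) σ y dy s) -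
      A (Λ (stateVec h y dy s))) (D := ‖Λ‖ * (C * ‖stateVec h y dy 0‖)) hM hα hαβ hA
    (by positivity) hsmall ht₀ (Λ.continuous.comp_continuousOn (hs.continuousOn_stateVec hh))
    (fun s hs₀ => by
      rw [add_sub_cancel]
      exact Λ.hasFDerivAt.comp_hasDerivWithinAt s (hs.hasDeriv_stateVec hh (ht₀.trans hs₀)))
    (fun T Z hZ hX s hsT => hR.norm_map_stateDeriv_sub_le hh hq hqh hα hσ hσ1 hZ hs hX hsT)
    (fun s hs₀ => Λ.le_opNorm_of_le (hinit y dy hs s ⟨hs₀.1, hs₀.2.trans_eq (by push_cast; ring)⟩))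
    ht
  exact hdecay.trans_eq (by ring)

theorem IsReduction.exists_forall_norm_map_stateVec_le (hR : IsReduction a₁ a₂ b kp ki kd Λ A)
    (hM : 0 ≤ M) (hA : SemigroupDecays A M β) (hβ : 0 < β) (hαβ : α < β) :
    ∃ r > 0, ∀ h σ : ℝ, 0 < h → h < r → 0 ≤ σ → σ < r → ∃ C, ∀ y dy : ℝ → ℝ,
      IsDifferenceSolution a₁ a₂ b h (delayOf h) kp ki kd σ y dy → ∀ t, 0 ≤ t →
        ‖Λ (stateVec h y dy t)‖ ≤ C * Real.exp (-α * t) * ‖stateVec h y dy 0‖ := by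
  set γ := max α 0
  have hγβ : γ < β := max_lt hαβ hβ
  have hγ : 0 < β - γ := sub_pos.2 hγβ
  set c := M * ‖Λ‖ + 1
  have hc0 : 0 < c := by positivity
  obtain ⟨r, hr, hr1, hgain⟩ := exists_perturbationGain_le a₁ a₂ b kp ki kd γ
    (ε := (β - γ) / (2 * c)) (by positivity)
  refine ⟨r, hr, fun h σ hh hhr hσ hσr => ?_⟩
  have hh1 : h ≤ 1 := hhr.le.trans hr1
  have hsmall : M * (‖Λ‖ * perturbationGain a₁ a₂ b h (delayOf h) kp ki kd σ γ) / (β - γ) ≤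
      1 / 2 := by
    rw [div_le_iff₀ hγ, ← mul_assoc]
    calc _ ≤ c * ((β - γ) / (2 * c)) :=
          mul_le_mul (by linarith) (hgain h σ hh hhr hσ hσr) (perturbationGain_nonneg hh.le) hc0.le
      _ = 1 / 2 * (β - γ) := by field_simp
  obtain ⟨C, hC, hdecay⟩ := hR.exists_norm_map_stateVec_le hM hA (le_max_right α 0) hγβ hh
    (delayOf_pos hh hh1) ((delayOf_mul_le_sqrt hh).trans (Real.sqrt_le_one.2 hh1)) hσ
    (hσr.le.trans hr1) hsmall
  refine ⟨C, fun y dy hs t ht => (hdecay y dy hs t ht).trans ?_⟩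
  have hαγ : α ≤ γ := le_max_left α 0
  gcongr

theorem PIDStabilizesFull.exists_eventStabilizesFull
    (H : PIDStabilizesFull a₁ a₂ b kp ki kd β) (hβ : 0 < β) (hαβ : α < β) :
    ∃ r > 0, ∀ h σ : ℝ, 0 < h → h < r → 0 ≤ σ → σ < r →
      EventStabilizesFull a₁ a₂ b h (delayOf h) (kp + kd / (delayOf h * h)) ki
        (-(kd / (delayOf h * h))) σ α := by
  obtain ⟨M, hM, hA⟩ := H.exists_semigroupDecays
  obtain ⟨r, hr, hdecay⟩ := isReduction_id.exists_forall_norm_map_stateVec_le hM hA hβ hαβ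
  exact ⟨r, hr, fun h σ hh hhr hσ hσr =>
    eventStabilizesFull_iff.2 (hdecay h σ hh hhr hσ hσr)⟩

/- If `b ki = 0`, the hypothesis says nothing about the integral, which then has no influence on the
plant; otherwise the integral decays too. -/
theorem PIDStabilizes.exists_eventStabilizes
    (H : PIDStabilizes a₁ a₂ b kp ki kd β) (hβ : 0 < β) (hαβ : α < β) :
    ∃ r > 0, ∀ h σ : ℝ, 0 < h → h < r → 0 ≤ σ → σ < r →
      EventStabilizes a₁ a₂ b h (delayOf h) (kp + kd / (delayOf h * h)) ki
        (-(kd / (delayOf h * h))) σ α := by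
  by_cases hb : b * ki = 0
  · obtain ⟨M, hM, hA⟩ := H.exists_semigroupDecays hb
    obtain ⟨r, hr, hdecay⟩ :=
      (isReduction_plantState hb).exists_forall_norm_map_stateVec_le hM hA hβ hαβ
    simp only [plantState_apply, norm_stateVec_zero] at hdecay
    exact ⟨r, hr, fun h σ hh hhr hσ hσr => eventStabilizes_iff.2 (hdecay h σ hh hhr hσ hσr)⟩
  · obtain ⟨r, hr, hfull⟩ := (H.pidStabilizesFull hb hβ.le).exists_eventStabilizesFull hβ hαβ
    exact ⟨r, hr, fun h σ hh hhr hσ hσr => (hfull h σ hh hhr hσ hσr).eventStabilizes⟩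

end Implementation

end PID

theorem theorem3 (a₁ a₂ b : ℝ) :
    (∀ (h : ℝ) (q : ℕ) (kp ki kd σ α : ℝ),
      0 < h → 0 < q → 0 ≤ σ → σ < 1 → 0 < α →
      PID.LMIFeasible a₁ a₂ b h q kp ki kd σ α →
        PID.EventStabilizes a₁ a₂ b h q kp ki kd σ α ∧
        PID.EventStabilizesFull a₁ a₂ b h q kp ki kd σ α) ∧
    (∀ kp' ki' kd' α' : ℝ, 0 < α' →
      (PID.PIDStabilizes a₁ a₂ b kp' ki' kd' α' →
        ∀ α : ℝ, α < α' → ∃ h₀ > 0, ∃ σ₀ > 0, ∀ h σ : ℝ, 0 < h → h < h₀ →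
          0 ≤ σ → σ < 1 → σ < σ₀ →
          PID.EventStabilizes a₁ a₂ b h (PID.delayOf h)
            (kp' + kd' / (PID.delayOf h * h)) ki' (-(kd' / (PID.delayOf h * h))) σ α) ∧
      (PID.PIDStabilizesFull a₁ a₂ b kp' ki' kd' α' →
        ∀ α : ℝ, α < α' → ∃ h₀ > 0, ∃ σ₀ > 0, ∀ h σ : ℝ, 0 < h → h < h₀ →
          0 ≤ σ → σ < 1 → σ < σ₀ →
          PID.EventStabilizesFull a₁ a₂ b h (PID.delayOf h)
            (kp' + kd' / (PID.delayOf h * h)) ki' (-(kd' / (PID.delayOf h * h))) σ α)) := by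
  refine ⟨fun h q kp ki kd σ α hh hq hσ hσ1 hα hL => ?_, fun kp ki kd β hβ =>
    ⟨fun H α hαβ => ?_, fun H α hαβ => ?_⟩⟩
  · have hfull := PID.eventStabilizesFull_of_LMIFeasible hh hq hσ hσ1.le hα.le hL
    exact ⟨hfull.eventStabilizes, hfull⟩
  · obtain ⟨r, hr, hstab⟩ := H.exists_eventStabilizes hβ hαβ
    exact ⟨r, hr, r, hr, fun h σ hh hhr hσ _ hσr => hstab h σ hh hhr hσ hσr⟩
  · obtain ⟨r, hr, hstab⟩ := H.exists_eventStabilizesFull hβ hαβ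
    exact ⟨r, hr, r, hr, fun h σ hh hhr hσ _ hσr => hstab h σ hh hhr hσ hσr⟩
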